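/- **Setting.** Let $\mathcal A$ be a non-empty set of external actions, $\tau\notin\mathcal A$, and $Act=\mathcal A\cup\{\tau\}$. Terms of $\mathrm{RCCS}_{fs}$ are $$T ::= \mathbf 0 \mid X \mid \textstyle\sum_{i\in I}\alpha_i.T_i \mid \bigoplus_{i\in I}p_i\tau.T_i \mid \mu X.T,$$ with $I$ finite and non-empty, $\alpha_i\in Act$, and in a probabilistic choice $|I|\ge 2$, $p_i\in(0,1)$, $\sum_i p_i=1$; in $\mu X.T$ every free occurrence of $X$ in $T$ lies inside a choice. A process is a term without free variables. The transition relation is generated by $\sum_i\alpha_i.T_i\xrightarrow{\alpha_i}T_i$, $\bigoplus_ip_i\tau.T_i\xrightarrow{p_i\tau}T_i$, and: if $T\{\mu X.T/X\}\xrightarrow{\lambda}T'$ then $\mu X.T\xrightarrow{\lambda}T'$. In the same way $\bigoplus_ip_i\tau.T_i$ and its fixpoint foldings have the collective silent transition $\xrightarrow{\coprod_ip_i\tau}\coprod_iT_i$. The relation $A\xrightarrow{\alpha}\rho$ ($\alpha\in Act$, $\rho$ a distribution on processes) is generated by $\sum_i\alpha_i.T_i\xrightarrow{\alpha_i}\delta_{T_i}$,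 $\bigoplus_ip_i\tau.T_i\xrightarrow{\tau}\sum_ip_i\delta_{T_i}$ and the same fixpoint rule. Let $\mathcal E$ denote an equivalence on processes. **Branching bisimulation.** An $\epsilon$-tree of $A$ with regard to $\mathcal E$ is a (possibly infinite) tree with nodes labelled in $[A]_{\mathcal E}$ and root labelled $A$, such that each node labelled $B$ is a leaf, or has one child $B'$ with $B\xrightarrow{\tau}B'$ and edge label $1$, or has $k\ge2$ children $B_1,\dots,B_k$ with edge labels $p_1,\dots,p_k$ and $B\xrightarrow{\coprod_{i\le k}p_i\tau}\coprod_{i\le k}B_i$. The probability of a finite path is the product of its edge labels. The convergence probability of the tree is the limit as $k\to\infty$ of the total probability of its root-to-leaf paths of length at most $k$. The tree is regular if this is $1$ and divergent if it is $0$. For a class $\mathcal C$: - $A\rightsquigarrow_{\mathcal E}\xrightarrow{\ell}\mathcal C$ (defined for $\ell\in\mathcal A$, or $\ell=\tau$ and $\mathcal C\neq[A]_{\mathcal E}$) if some regular $\epsilon$-tree of $A$ is such that each leaf $L$ has a transition $L\xrightarrow{\ell}L'$ with $L'\in\mathcal C$; - $A\rightsquigarrow_{\mathcal E}\xrightarrow{q}\mathcal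 C$ (defined for $\mathcal C\ne[A]_{\mathcal E}$) if some regular $\epsilon$-tree of $A$ is such that each leaf $L$ has a collective silent transition that stays in $[L]_{\mathcal E}$ with probability less than $1$ and whose conditional probability of arriving in $\mathcal C$, given that it leaves $[L]_{\mathcal E}$, is $q$. $\mathcal E$ is a branching bisimulation if, whenever $A\mathrel{\mathcal E}B$, all these $\ell$-transitions and $q$-transitions of $A$ are also transitions of $B$ to the same class. **Weak bisimulation.** A scheduler of $A$ assigns to each finite execution fragment of $A$ a distribution over the transitions $B\xrightarrow{\alpha}\rho$ whose source $B$ is the last state of the fragment, together with termination. It induces probabilities of terminating after each finite fragment. Write $A\stackrel{\alpha}{\Longrightarrow}_c\rho$ if for some scheduler these probabilities sum to $1$, every fragment of positive probability has as its sequence of external actions $\alpha$ if $\alpha\in\mathcal A$, and the empty word if $\alpha=\tau$, and the last state is distributed as $\rho$. $\mathcal E$ is a weak bisimulation if, whenever $A\mathrel{\mathcal E}B$ and $A\xrightarrow{\alpha}\rho_A$, there is $\rho_B$ with $B\stackrel{\alpha}{\Longrightarrow}_c\rho_B$ and $\rho_A\mathrel{\mathcal E^\dagger}\rho_B$, where $\mathcal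 E^\dagger$ is the lifting of $\mathcal E$ to distributions by weighting functions (couplings supported on $\mathcal E$). **Divergence.** $\mathcal E$ is divergent $\epsilon$-tree preserving if, whenever $A\mathrel{\mathcal E}B$, $A$ has a divergent $\epsilon$-tree with regard to $\mathcal E$ iff $B$ has one. A $\tau$-EC of a process $A$ is a strongly connected subgraph, with at least one edge, of the transition graph of the processes reachable from $A$, all of whose edges are labelled $\tau$ or $p\tau$, and which contains with any edge labelled $q\tau$ from $C$ to $D$ all the edges of a collective silent transition of $C$ that has $C\xrightarrow{q\tau}D$ as one of its branches. A relation $\mathcal R$ is $\tau$-EC invariant if, whenever $A\mathrel{\mathcal R}B$: for each $\tau$-EC $\mathsf{ec}_1$ that $A$ can reach by edges labelled $\tau$ or $p\tau$, $B$ can reach in this way a $\tau$-EC $\mathsf{ec}_2$ such that each vertex $D$ of $\mathsf{ec}_2$ has some vertex $C$ of $\mathsf{ec}_1$ with $C\mathrel{\mathcal R}D$; and the same holds with $A,B$ exchanged and $\mathcal R^{-1}$ in place of $\mathcal R$. **Bisimilarities.** $\simeq$, $\simeq^\Delta$, $\simeq_e$ are the unions of all branching bisimulations, of those that are divergent $\epsilon$-tree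 preserving, and of those that are $\tau$-EC invariant, respectively; $\approx$ and $\approx_e$ are the unions of all weak bisimulations and of those that are $\tau$-EC invariant, respectively. **Theorem.** 1. $\simeq^{\Delta}\;\subsetneq\;\simeq_e\;\subsetneq\;\simeq$ and $\approx_e\;\subsetneq\;\approx$; 2. $\simeq\;\subsetneq\;\approx$, $\simeq_e\;\subsetneq\;\approx_e$, and $\approx_e\;\not\subseteq\;\simeq\;\not\subseteq\;\approx_e$. -/

import Mathlib

open scoped ENNReal

namespace RCCS

universe u

/-- Actions: the external actions `a ∈ 𝒜` and the internal action `τ`. -/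
inductive Act (𝒜 : Type u) : Type u
  | ext (a : 𝒜) : Act 𝒜
  | tau : Act 𝒜

/-- Transition labels: actions, and probabilistic silent labels `pτ` with `0 < p < 1`. -/
inductive Label (𝒜 : Type u) : Type u
  | act (α : Act 𝒜) : Label 𝒜
  | ptau (p : ℝ) (hp : 0 < p ∧ p < 1) : Label 𝒜

/-- Families `(p_i)` with `p_i ∈ (0,1)` and `∑ p_i = 1`. -/
structure Weights (n : ℕ) where
  p : Fin n → ℝ
  mem : ∀ i, 0 < p i ∧ p i < 1
  sum_eq_one : ∑ i, p i = 1

/-- The distribution on the index set given by a family of weights. -/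
noncomputable def Weights.dist {n : ℕ} (w : Weights n) : PMF (Fin n) :=
  PMF.ofFintype (fun i => ENNReal.ofReal (w.p i)) (by
    rw [← ENNReal.ofReal_sum_of_nonneg (fun i _ => (w.mem i).1.le), w.sum_eq_one,
      ENNReal.ofReal_one])

/-- Terms, with process variables named by natural numbers: nil, variables, nondeterministic
choices `∑ α_i.T_i` over a non-empty finite index set, probabilistic choices `⨁ p_iτ.T_i` over a
finite index set with at least two elements, and fixpoints `μX.T`. -/
inductive Term (𝒜 : Type u) : Type u
  | nil : Term 𝒜
  | var (X : ℕ) : Term 𝒜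
  | sum (n : ℕ) (α : Fin (n + 1) → Act 𝒜) (T : Fin (n + 1) → Term 𝒜) : Term 𝒜
  | prob (n : ℕ) (w : Weights (n + 2)) (T : Fin (n + 2) → Term 𝒜) : Term 𝒜
  | mu (X : ℕ) (T : Term 𝒜) : Term 𝒜

namespace Term

variable {𝒜 : Type u}

/-- `Free X T`: the variable `X` occurs free in `T`. -/
def Free (X : ℕ) : Term 𝒜 → Prop
  | nil => False
  | var Y => Y = X
  | sum _ _ T => ∃ i, Free X (T i)
  | prob _ _ T => ∃ i, Free X (T i)
  | mu Y T => Y ≠ X ∧ Free X T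

/-- `Unguarded X T`: the variable `X` has a free occurrence in `T` that lies inside no
nondeterministic or probabilistic choice. -/
def Unguarded (X : ℕ) : Term 𝒜 → Prop
  | nil => False
  | var Y => Y = X
  | sum _ _ _ => False
  | prob _ _ _ => False
  | mu Y T => Y ≠ X ∧ Unguarded X T

/-- In every fixpoint subterm `μX.T` the variable `X` is guarded in `T`. -/
def WellGuarded : Term 𝒜 → Prop
  | nil => True
  | var _ => True
  | sum _ _ T => ∀ i, WellGuarded (T i)
  | prob _ _ T => ∀ i, WellGuarded (T i)
  | mu X T => ¬ Unguarded X T ∧ WellGuarded T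

/-- `subst X P T` is the substitution `T{P/X}`. It is only used with `P` closed, so no variable is captured. -/
def subst (X : ℕ) (P : Term 𝒜) : Term 𝒜 → Term 𝒜
  | nil => nil
  | var Y => if Y = X then P else var Y
  | sum n α T => sum n α (fun i => subst X P (T i))
  | prob n w T => prob n w (fun i => subst X P (T i))
  | mu Y T => if Y = X then mu Y T else mu Y (subst X P T)

/-- A process is a (well-guarded) term without free variables. -/
def IsProc (T : Term 𝒜) : Prop := T.WellGuarded ∧ ∀ X, ¬ T.Free X

/-- The labelled transition system. -/
inductive Step : Term 𝒜 → Label 𝒜 → Term 𝒜 → Prop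
  | sum (n : ℕ) (α : Fin (n + 1) → Act 𝒜) (T : Fin (n + 1) → Term 𝒜) (i : Fin (n + 1)) :
      Step (.sum n α T) (.act (α i)) (T i)
  | prob (n : ℕ) (w : Weights (n + 2)) (T : Fin (n + 2) → Term 𝒜) (i : Fin (n + 2)) :
      Step (.prob n w T) (.ptau (w.p i) (w.mem i)) (T i)
  | mu (X : ℕ) (T : Term 𝒜) (l : Label 𝒜) (T' : Term 𝒜) :
      Step (subst X (.mu X T) T) l T' → Step (.mu X T) l T'

/-- Collective silent transitions: all branches of a probabilistic choice taken together. -/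
inductive CollStep : Term 𝒜 → (n : ℕ) → Weights (n + 2) → (Fin (n + 2) → Term 𝒜) → Prop
  | prob (n : ℕ) (w : Weights (n + 2)) (T : Fin (n + 2) → Term 𝒜) :
      CollStep (.prob n w T) n w T
  | mu (X : ℕ) (T : Term 𝒜) (n : ℕ) (w : Weights (n + 2)) (T' : Fin (n + 2) → Term 𝒜) :
      CollStep (subst X (.mu X T) T) n w T' → CollStep (.mu X T) n w T'

/-- The probabilistic labelled transition system. -/
inductive PStep : Term 𝒜 → Act 𝒜 → PMF (Term 𝒜) → Prop
  | sum (n : ℕ) (α : Fin (n + 1) → Act 𝒜) (T : Fin (n + 1) → Term 𝒜) (i : Fin (n + 1)) :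
      PStep (.sum n α T) (α i) (PMF.pure (T i))
  | prob (n : ℕ) (w : Weights (n + 2)) (T : Fin (n + 2) → Term 𝒜) :
      PStep (.prob n w T) .tau (w.dist.map T)
  | mu (X : ℕ) (T : Term 𝒜) (β : Act 𝒜) (ρ : PMF (Term 𝒜)) :
      PStep (subst X (.mu X T) T) β ρ → PStep (.mu X T) β ρ

end Term

/-- The processes. -/
def Proc (𝒜 : Type u) : Type u := {T : Term 𝒜 // T.IsProc}

variable {𝒜 : Type u}

namespace Proc

/-! The three transition relations on processes. A process only evolves into processes, so that
they are the restrictions of the relations on terms. -/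

def Step (A : Proc 𝒜) (l : Label 𝒜) (A' : Proc 𝒜) : Prop :=
  Term.Step A.1 l A'.1

def CollStep (A : Proc 𝒜) (n : ℕ) (w : Weights (n + 2)) (P : Fin (n + 2) → Proc 𝒜) : Prop :=
  Term.CollStep A.1 n w (fun i => (P i).1)

def PStep (A : Proc 𝒜) (α : Act 𝒜) (ρ : PMF (Proc 𝒜)) : Prop :=
  Term.PStep A.1 α (ρ.map Subtype.val)

end Proc

/-! ### Epsilon-trees and branching bisimulation -/

/-- An `ε`-tree of `A` with regard to `E`. A node is addressed by the path that leads to it, read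
from the node up to the root: `[]` is the root and the children of the node `u` are
`i :: u` for `i < arity u`. The values of the functions at lists that are no nodes are irrelevant.
`lab u` is the label of the node `u` and `edge (i :: u)` the label of the edge from `u` to its
`i`-th child. -/
structure EpsTree (E : Setoid (Proc 𝒜)) (A : Proc 𝒜) where
  arity : List ℕ → ℕ
  lab : List ℕ → Proc 𝒜
  edge : List ℕ → ℝ
  /-- The list addresses a node of the tree. -/
  IsNode : List ℕ → Prop
  isNode_nil : IsNode []
  isNode_cons : ∀ i u, IsNode (i :: u) ↔ IsNode u ∧ i < arity u
  lab_root : lab [] = A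
  lab_mem : ∀ u, IsNode u → E.r (lab u) A
  children : ∀ u, IsNode u →
    arity u = 0 ∨
    (arity u = 1 ∧ (lab u).Step (.act .tau) (lab (0 :: u)) ∧ edge (0 :: u) = 1) ∨
    ∃ (n : ℕ) (w : Weights (n + 2)),
      arity u = n + 2 ∧
      (lab u).CollStep n w (fun i => lab ((i : ℕ) :: u)) ∧
      ∀ i : Fin (n + 2), edge ((i : ℕ) :: u) = w.p i

namespace EpsTree

variable {E : Setoid (Proc 𝒜)} {A : Proc 𝒜}

def IsLeaf (t : EpsTree E A) (u : List ℕ) : Prop := t.IsNode u ∧ t.arity u = 0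

/-- The probability of the finite path from the root to a node. -/
def pathProb (t : EpsTree E A) : List ℕ → ℝ
  | [] => 1
  | i :: u => t.edge (i :: u) * t.pathProb u

/-- The total probability of the finite branches of length at most `k`. -/
noncomputable def convProb (t : EpsTree E A) (k : ℕ) : ℝ≥0∞ :=
  ∑' u : {u : List ℕ // t.IsLeaf u ∧ u.length ≤ k}, ENNReal.ofReal (t.pathProb u.1)

/-- The convergence probability is `1`. -/
def Regular (t : EpsTree E A) : Prop := Filter.Tendsto t.convProb Filter.atTop (nhds 1)

/-- The convergence probability is `0`. -/
def Divergent (t : EpsTree E A) : Prop := Filter.Tendsto t.convProb Filter.atTop (nhds 0)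

end EpsTree

/-- The `ℓ`-transition from `A` to the class `C`. -/
def EllTrans (E : Setoid (Proc 𝒜)) (A : Proc 𝒜) (l : Act 𝒜) (C : Quotient E) : Prop :=
  ∃ t : EpsTree E A, t.Regular ∧
    ∀ u, t.IsLeaf u → ∃ L' : Proc 𝒜, (t.lab u).Step (.act l) L' ∧ Quotient.mk E L' = C

open Classical in
/-- The probability that a collective silent transition with weights `w` and targets `P` arrives
at the class `C`. -/
noncomputable def arrive (E : Setoid (Proc 𝒜)) {n : ℕ} (w : Weights n) (P : Fin n → Proc 𝒜)
    (C : Quotient E) : ℝ :=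
  ∑ i, if Quotient.mk E (P i) = C then w.p i else 0

/-- The `q`-transition from `A` to the class `C`. The normalized probability of a leaf makes sense
only if its transition leaves the class of the leaf with positive probability. -/
def QTrans (E : Setoid (Proc 𝒜)) (A : Proc 𝒜) (q : ℝ) (C : Quotient E) : Prop :=
  ∃ t : EpsTree E A, t.Regular ∧
    ∀ u, t.IsLeaf u → ∃ (n : ℕ) (w : Weights (n + 2)) (P : Fin (n + 2) → Proc 𝒜),
      (t.lab u).CollStep n w P ∧
      arrive E w P (Quotient.mk E (t.lab u)) < 1 ∧
      arrive E w P C / (1 - arrive E w P (Quotient.mk E (t.lab u))) = q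

def IsBranchingBisim (E : Setoid (Proc 𝒜)) : Prop :=
  ∀ A B : Proc 𝒜, E.r A B → ∀ C : Quotient E,
    (∀ l : Act 𝒜, ((∃ a, l = .ext a) ∨ (l = .tau ∧ C ≠ Quotient.mk E A)) →
      EllTrans E A l C → EllTrans E B l C) ∧
    (∀ q : ℝ, C ≠ Quotient.mk E A → QTrans E A q C → QTrans E B q C)

/-! ### Weak bisimulation -/

/-- `Frag A B` is the type of finite execution fragments that start in `A` and end in `B`. -/
inductive Frag (A : Proc 𝒜) : Proc 𝒜 → Type u
  | nil : Frag A A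
  | snoc {B : Proc 𝒜} (ω : Frag A B) (α : Act 𝒜) (C : Proc 𝒜)
      (h : ∃ ρ : PMF (Proc 𝒜), B.PStep α ρ ∧ 0 < ρ C) : Frag A C

/-- The external actions of a fragment, in order. -/
def Frag.trace {A : Proc 𝒜} : {B : Proc 𝒜} → Frag A B → List 𝒜
  | _, .nil => []
  | _, .snoc ω (.ext a) _ _ => ω.trace ++ [a]
  | _, .snoc ω .tau _ _ => ω.trace

/-- `α̂`: the one-letter word `a` for an external action `a`, the empty word for `τ`. -/
def Act.hat : Act 𝒜 → List 𝒜
  | .ext a => [a]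
  | .tau => []

/-- The transitions of the probabilistic transition system with source `B`. -/
def Tr (B : Proc 𝒜) : Type u := {x : Act 𝒜 × PMF (Proc 𝒜) // B.PStep x.1 x.2}

/-- A scheduler of `A` assigns to each finite execution fragment of `A` a distribution over the
transitions that leave its last state, together with `none` (no further transition). -/
def Scheduler (A : Proc 𝒜) : Type u := (B : Proc 𝒜) → Frag A B → PMF (Option (Tr B))

namespace Scheduler

variable {A : Proc 𝒜}

open Classical in
/-- The probability of the cone of a finite execution fragment. -/
noncomputable def cone (σ : Scheduler A) : {B : Proc 𝒜} → Frag A B → ℝ≥0∞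
  | _, .nil => 1
  | _, .snoc (B := B) ω α C _ =>
      σ.cone ω * ∑' tr : Tr B, if tr.1.1 = α then σ B ω (some tr) * tr.1.2 C else 0

/-- The probability that the execution is exactly the given fragment. -/
noncomputable def stopProb (σ : Scheduler A) {B : Proc 𝒜} (ω : Frag A B) : ℝ≥0∞ :=
  σ.cone ω * σ B ω none

end Scheduler

/-- The weak combined transition from `A` to `ρ` labelled by `α`. -/
def WeakCombined (A : Proc 𝒜) (α : Act 𝒜) (ρ : PMF (Proc 𝒜)) : Prop :=
  ∃ σ : Scheduler A,
    (∑' ω : (B : Proc 𝒜) × Frag A B, σ.stopProb ω.2) = 1 ∧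
    (∀ (B : Proc 𝒜) (ω : Frag A B), 0 < σ.stopProb ω → ω.trace = α.hat) ∧
    (∀ B : Proc 𝒜, (∑' ω : Frag A B, σ.stopProb ω) = ρ B)

/-- The lifting of a relation to distributions, through weighting functions. -/
def Lift {X Y : Type u} (R : X → Y → Prop) (ρ₁ : PMF X) (ρ₂ : PMF Y) : Prop :=
  ∃ w : X → Y → ℝ≥0∞,
    (∀ x y, w x y ≤ 1) ∧
    (∀ x y, 0 < w x y → R x y) ∧
    (∀ x, ∑' y, w x y = ρ₁ x) ∧
    (∀ y, ∑' x, w x y = ρ₂ y)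

def IsWeakBisim (E : Setoid (Proc 𝒜)) : Prop :=
  ∀ A B : Proc 𝒜, E.r A B → ∀ (α : Act 𝒜) (ρA : PMF (Proc 𝒜)), A.PStep α ρA →
    ∃ ρB : PMF (Proc 𝒜), WeakCombined B α ρB ∧ Lift E.r ρA ρB

/-! ### Divergence -/

/-- `A` is divergent with respect to `E`. -/
def Diverges (E : Setoid (Proc 𝒜)) (A : Proc 𝒜) : Prop := ∃ t : EpsTree E A, t.Divergent

def DivPreserving (E : Setoid (Proc 𝒜)) : Prop :=
  ∀ A B : Proc 𝒜, E.r A B → (Diverges E A ↔ Diverges E B)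

/-- The labels `τ` and `pτ`. -/
def Label.Silent : Label 𝒜 → Prop
  | .act (.ext _) => False
  | .act .tau => True
  | .ptau _ _ => True

/-- `B` is reachable from `A`, that is, a vertex of the induced transition graph of `A`. -/
def Reachable (A B : Proc 𝒜) : Prop :=
  Relation.ReflTransGen (fun C D : Proc 𝒜 => ∃ l, C.Step l D) A B

/-- `B` is reachable from `A` through silent transitions. -/
def SilentReachable (A B : Proc 𝒜) : Prop :=
  Relation.ReflTransGen (fun C D : Proc 𝒜 => ∃ l : Label 𝒜, l.Silent ∧ C.Step l D) A B

/-- A set of vertices and a set of labelled edges. -/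
structure Graph (𝒜 : Type u) where
  V : Set (Proc 𝒜)
  E : Set (Proc 𝒜 × Label 𝒜 × Proc 𝒜)

/-- The graph `g` is a `τ`-end component of `B`. A single vertex without any edge is not one: a
`τ`-end component stands for a silent cycle. -/
structure IsTauEC (B : Proc 𝒜) (g : Graph 𝒜) : Prop where
  vert : ∀ C ∈ g.V, Reachable B C
  edge : ∀ C l D, (C, l, D) ∈ g.E → C ∈ g.V ∧ D ∈ g.V ∧ C.Step l D
  nontrivial : g.E.Nonempty
  connected : ∀ C ∈ g.V, ∀ D ∈ g.V,
    Relation.ReflTransGen (fun C' D' : Proc 𝒜 => ∃ l, (C', l, D') ∈ g.E) C D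
  silent : ∀ C l D, (C, l, D) ∈ g.E → l.Silent
  closed : ∀ C q hq D, (C, Label.ptau q hq, D) ∈ g.E →
    ∃ (n : ℕ) (w : Weights (n + 2)) (P : Fin (n + 2) → Proc 𝒜), C.CollStep n w P ∧
      (∃ k, w.p k = q ∧ P k = D) ∧
      ∀ i, (C, Label.ptau (w.p i) (w.mem i), P i) ∈ g.E

/-- The process `A` can silently reach the `τ`-end component `g`. -/
def ReachesEC (A : Proc 𝒜) (g : Graph 𝒜) : Prop :=
  IsTauEC A g ∧ ∃ A', SilentReachable A A' ∧ A' ∈ g.V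

/-- `g₁` is related to `g₂` with regard to `R`. -/
def RelatedEC (R : Proc 𝒜 → Proc 𝒜 → Prop) (g₁ g₂ : Graph 𝒜) : Prop :=
  ∀ B ∈ g₂.V, ∃ A ∈ g₁.V, R A B

def TauECInvariant (R : Proc 𝒜 → Proc 𝒜 → Prop) : Prop :=
  ∀ A B : Proc 𝒜, R A B →
    (∀ g₁, ReachesEC A g₁ → ∃ g₂, ReachesEC B g₂ ∧ RelatedEC R g₁ g₂) ∧
    (∀ g₂, ReachesEC B g₂ → ∃ g₁, ReachesEC A g₁ ∧ RelatedEC (fun C D => R D C) g₂ g₁)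

/-! ### The five bisimilarities -/

/-- Branching bisimilarity `≃`. -/
def branchingBisim (𝒜 : Type u) : Set (Proc 𝒜 × Proc 𝒜) :=
  {x | ∃ E : Setoid (Proc 𝒜), IsBranchingBisim E ∧ E.r x.1 x.2}

/-- Branching bisimilarity with explicit divergence `≃^Δ`. -/
def branchingBisimDelta (𝒜 : Type u) : Set (Proc 𝒜 × Proc 𝒜) :=
  {x | ∃ E : Setoid (Proc 𝒜), (IsBranchingBisim E ∧ DivPreserving E) ∧ E.r x.1 x.2}

/-- Exhaustive branching bisimilarity `≃_e`. -/
def branchingBisimExh (𝒜 : Type u) : Set (Proc 𝒜 × Proc 𝒜) :=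
  {x | ∃ E : Setoid (Proc 𝒜), (IsBranchingBisim E ∧ TauECInvariant E.r) ∧ E.r x.1 x.2}

/-- Weak bisimilarity `≈`. -/
def weakBisim (𝒜 : Type u) : Set (Proc 𝒜 × Proc 𝒜) :=
  {x | ∃ E : Setoid (Proc 𝒜), IsWeakBisim E ∧ E.r x.1 x.2}

/-- Exhaustive weak bisimilarity `≈_e`. -/
def weakBisimExh (𝒜 : Type u) : Set (Proc 𝒜 × Proc 𝒜) :=
  {x | ∃ E : Setoid (Proc 𝒜), (IsWeakBisim E ∧ TauECInvariant E.r) ∧ E.r x.1 x.2}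

end RCCS

/-! Two inclusions carry the content; in the others the same equivalence serves on both sides, with
a condition dropped or carried along.

For ≃^Δ ⊆ ≃_e (`IsBranchingBisim.tauECInvariant`), let `A` silently reach an end component `g`. A
related `B` silently reaches some `B'` related to a vertex of `g`. If `g` lies in one class,
unfolding it gives a divergent tree, so `B'` has one too, and each label of that tree has a silent
transition to labels of the same tree. If `g` meets several classes, strong connectedness makes some
edge of `g` leave each of them, and by bisimilarity every process of these classes has a silent
transition into their union. Since a process has finitely many derivatives (`finite_reachable`),
both cases give a finite set in which each process has a silent transition into the set, and such a
set contains an end component (`exists_isTauEC`).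

For ≃ ⊆ ≈ (`IsBranchingBisim.isWeakBisim`), every process of the class has a path of positive
probability, inside the class, to a transition of the wanted kind. As only finitely many processes
are reachable, a scheduler that follows shortest paths terminates almost surely
(`Strategy.tsum_active_ne_top`). A probabilistic step of `A` that stays in its class with
probability `a < 1` is matched by stopping at `B` at once with probability `a` and otherwise running
until the class is left; equality of the conditional probabilities yields the right mass on each
class (`IsBranchingBisim.exists_weakCombined_coll`).

Three pairs separate the relations. Ω and 0 are branching bisimilar, but only Ω has an end
component. The processes τ.a + τ.0 + a and τ.a + τ.0 have no end component and are weakly bisimilar,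
but the second cannot perform a without first leaving its branching class. Finally `looping` has a
silent self-loop which its unrolling reaches only through a gamble that may end in 0: the same end
components up to equivalence, but only `looping` has a divergent tree. -/

namespace RCCS

universe u

variable {𝒜 : Type u}

/-! ### Substitution and transitions of terms -/

namespace Term

theorem Unguarded.free {X : ℕ} {T : Term 𝒜} (h : Unguarded X T) : Free X T := by
  induction T with
  | nil => exact h
  | var Y => exact h
  | sum n α T ih => exact h.elim
  | prob n w T ih => exact h.elim
  | mu Y T ih => exact ⟨h.1, ih h.2⟩

theorem free_subst {X Y : ℕ} {P T : Term 𝒜} (h : Free Y (subst X P T)) :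
    (Free Y T ∧ Y ≠ X) ∨ Free Y P := by
  induction T with
  | nil => exact h.elim
  | var Z =>
    by_cases hZ : Z = X
    · right; simpa [subst, hZ] using h
    · left
      simp only [subst, hZ, if_false, Free] at h
      exact ⟨h, fun e => hZ (h.trans e)⟩
  | sum n α T ih =>
    obtain ⟨i, hi⟩ := h
    exact (ih i hi).imp_left fun h => ⟨⟨i, h.1⟩, h.2⟩
  | prob n w T ih =>
    obtain ⟨i, hi⟩ := h
    exact (ih i hi).imp_left fun h => ⟨⟨i, h.1⟩, h.2⟩
  | mu Z T ih =>
    by_cases hZ : Z = X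
    · left
      simp only [subst, hZ, if_true] at h ⊢
      exact ⟨h, fun e => h.1 e.symm⟩
    · simp only [subst, hZ, if_false] at h
      exact (ih h.2).imp_left fun h' => ⟨⟨h.1, h'.1⟩, h'.2⟩

theorem unguarded_subst {X Y : ℕ} {P T : Term 𝒜} (hP : ∀ Z, ¬ P.Free Z)
    (h : Unguarded Y (subst X P T)) : Unguarded Y T := by
  induction T with
  | nil => exact h
  | var Z =>
    by_cases hZ : Z = X
    · simp only [subst, hZ, if_true] at h
      exact (hP _ h.free).elim
    · simpa [subst, hZ] using h
  | sum n α T ih => exact h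
  | prob n w T ih => exact h
  | mu Z T ih =>
    by_cases hZ : Z = X
    · simpa [subst, hZ] using h
    · simp only [subst, hZ, if_false] at h
      exact ⟨h.1, ih h.2⟩

theorem WellGuarded.subst {X : ℕ} {P T : Term 𝒜} (hP : P.IsProc) (h : T.WellGuarded) :
    (subst X P T).WellGuarded := by
  induction T with
  | nil => exact h
  | var Z =>
    by_cases hZ : Z = X
    · simpa [Term.subst, hZ] using hP.1
    · simp [Term.subst, hZ, WellGuarded]
  | sum n α T ih => exact fun i => ih i (h i)
  | prob n w T ih => exact fun i => ih i (h i)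
  | mu Z T ih =>
    by_cases hZ : Z = X
    · simpa [Term.subst, hZ] using h
    · simp only [Term.subst, hZ, if_false]
      exact ⟨fun h' => h.1 (unguarded_subst hP.2 h'), ih h.2⟩

theorem IsProc.unfold {X : ℕ} {T : Term 𝒜} (h : (mu X T).IsProc) :
    (Term.subst X (mu X T) T).IsProc := by
  refine ⟨h.1.2.subst h, fun Y hY => ?_⟩
  rcases free_subst hY with h' | h'
  · exact h.2 Y ⟨fun e => h'.2 e.symm, h'.1⟩
  · exact h.2 Y h'

theorem Step.isProc {T T' : Term 𝒜} {l : Label 𝒜} (h : Step T l T') (hT : T.IsProc) :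
    T'.IsProc := by
  induction h with
  | sum n α T i => exact ⟨hT.1 i, fun X hX => hT.2 X ⟨i, hX⟩⟩
  | prob n w T i => exact ⟨hT.1 i, fun X hX => hT.2 X ⟨i, hX⟩⟩
  | mu X T l T' _ ih => exact ih hT.unfold

theorem CollStep.step {T : Term 𝒜} {n : ℕ} {w : Weights (n + 2)} {P : Fin (n + 2) → Term 𝒜}
    (h : CollStep T n w P) (i : Fin (n + 2)) : Step T (.ptau (w.p i) (w.mem i)) (P i) := by
  induction h with
  | prob n w T => exact .prob n w T i
  | mu X T n w T' _ ih => exact .mu _ _ _ _ (ih i)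

theorem Step.exists_collStep {T T' : Term 𝒜} {p : ℝ} {hp : 0 < p ∧ p < 1}
    (h : Step T (.ptau p hp) T') :
    ∃ (n : ℕ) (w : Weights (n + 2)) (P : Fin (n + 2) → Term 𝒜) (i : Fin (n + 2)),
      CollStep T n w P ∧ w.p i = p ∧ P i = T' := by
  generalize hl : Label.ptau p hp = l at h
  induction h with
  | sum n α T i => cases hl
  | prob n w T i => cases hl; exact ⟨n, w, T, i, .prob _ _ _, rfl, rfl⟩
  | mu X T l T' _ ih =>
    obtain ⟨n, w, P, i, h, h'⟩ := ih hl
    exact ⟨n, w, P, i, .mu _ _ _ _ _ h, h'⟩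

theorem CollStep.not_act {T T' : Term 𝒜} {n : ℕ} {w : Weights (n + 2)}
    {P : Fin (n + 2) → Term 𝒜} {α : Act 𝒜} (h : CollStep T n w P) : ¬ Step T (.act α) T' := by
  induction h with
  | prob n w T => intro h; cases h
  | mu X T n w P _ ih => intro h; cases h with | mu _ _ _ _ h => exact ih h

/-- A probabilistic choice has one collective transition and unfolding a fixpoint adds none. This
makes the conditional probabilities of a process well defined. -/
theorem CollStep.unique {T : Term 𝒜} {n n' : ℕ} {w : Weights (n + 2)} {w' : Weights (n' + 2)}
    {P : Fin (n + 2) → Term 𝒜} {P' : Fin (n' + 2) → Term 𝒜}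
    (h : CollStep T n w P) (h' : CollStep T n' w' P') : n = n' ∧ w ≍ w' ∧ P ≍ P' := by
  induction h with
  | prob n w T => cases h'; exact ⟨rfl, .rfl, .rfl⟩
  | mu X T n w P _ ih => cases h' with | mu _ _ _ _ _ h => exact ih h

theorem Step.pStep {T T' : Term 𝒜} {α : Act 𝒜} (h : Step T (.act α) T') :
    PStep T α (PMF.pure T') := by
  generalize hl : Label.act α = l at h
  induction h with
  | sum n β T i => cases hl; exact .sum _ _ _ _
  | prob n w T i => cases hl
  | mu X T l T' _ ih => exact .mu _ _ _ _ (ih hl)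

theorem CollStep.pStep {T : Term 𝒜} {n : ℕ} {w : Weights (n + 2)} {P : Fin (n + 2) → Term 𝒜}
    (h : CollStep T n w P) : PStep T .tau (w.dist.map P) := by
  induction h with
  | prob n w T => exact .prob _ _ _
  | mu X T n w P _ ih => exact .mu _ _ _ _ ih

theorem PStep.cases' {T : Term 𝒜} {α : Act 𝒜} {ρ : PMF (Term 𝒜)} (h : PStep T α ρ) :
    (∃ T', Step T (.act α) T' ∧ ρ = PMF.pure T') ∨
    (α = .tau ∧ ∃ (n : ℕ) (w : Weights (n + 2)) (P : Fin (n + 2) → Term 𝒜),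
      CollStep T n w P ∧ ρ = w.dist.map P) := by
  induction h with
  | sum n α T i => exact .inl ⟨_, .sum _ _ _ _, rfl⟩
  | prob n w T => exact .inr ⟨rfl, n, w, T, .prob _ _ _, rfl⟩
  | mu X T β ρ _ ih =>
    rcases ih with ⟨T', h, e⟩ | ⟨e, n, w, P, h, e'⟩
    · exact .inl ⟨T', .mu _ _ _ _ h, e⟩
    · exact .inr ⟨e, n, w, P, .mu _ _ _ _ _ h, e'⟩

/-! Finiteness of the transition graph. -/

/-- Simultaneous substitution. -/
def msubst (σ : ℕ → Option (Term 𝒜)) : Term 𝒜 → Term 𝒜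
  | nil => nil
  | var Y => (σ Y).getD (var Y)
  | sum n α T => sum n α (fun i => msubst σ (T i))
  | prob n w T => prob n w (fun i => msubst σ (T i))
  | mu Y T => mu Y (msubst (Function.update σ Y none) T)

theorem msubst_none (T : Term 𝒜) : msubst (fun _ => none) T = T := by
  induction T with
  | nil => rfl
  | var Y => rfl
  | sum n α T ih => simp [msubst, ih]
  | prob n w T ih => simp [msubst, ih]
  | mu Y T ih =>
    simp [msubst, ih]

theorem subst_of_not_free {X : ℕ} {P T : Term 𝒜} (h : ¬ T.Free X) : subst X P T = T := by
  induction T with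
  | nil => rfl
  | var Y => simp only [Free] at h; simp [subst, h]
  | sum n α T ih =>
    simp only [Free, not_exists] at h
    simp [subst, fun i => ih i (h i)]
  | prob n w T ih =>
    simp only [Free, not_exists] at h
    simp [subst, fun i => ih i (h i)]
  | mu Y T ih =>
    by_cases hY : Y = X
    · simp [subst, hY]
    · simp only [subst, hY, if_false]
      rw [ih fun h' => h ⟨hY, h'⟩]

/-- The values of `σ` are closed, so the outer substitution acts only on the occurrences of `X` that
`σ` leaves in place. -/
theorem subst_msubst {X : ℕ} {Q T : Term 𝒜} {σ : ℕ → Option (Term 𝒜)}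
    (hσ : ∀ Y P, σ Y = some P → ∀ Z, ¬ P.Free Z) (hX : σ X = none) :
    subst X Q (msubst σ T) = msubst (Function.update σ X (some Q)) T := by
  induction T generalizing σ with
  | nil => rfl
  | var Y =>
    by_cases hY : Y = X
    · subst hY; simp [msubst, subst, hX]
    · cases h : σ Y with
      | none => simp [msubst, subst, h, hY]
      | some P =>
        simp only [msubst, Function.update_of_ne hY, h, Option.getD_some]
        exact subst_of_not_free (hσ Y P h X)
  | sum n α T ih => simp [msubst, subst, fun i => ih i hσ hX]
  | prob n w T ih => simp [msubst, subst, fun i => ih i hσ hX]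
  | mu Y T ih =>
    by_cases hY : Y = X
    · subst hY; simp [msubst, subst]
    · simp only [msubst, subst, hY, if_false]
      rw [ih, Function.update_comm (Ne.symm hY)]
      · intro Z P h
        by_cases hZ : Z = Y
        · subst hZ; simp at h
        · rw [Function.update_of_ne hZ] at h; exact hσ Z P h
      · rw [Function.update_of_ne (Ne.symm hY)]; exact hX

theorem free_msubst {X : ℕ} {T : Term 𝒜} {σ : ℕ → Option (Term 𝒜)}
    (hσ : ∀ Y P, σ Y = some P → ∀ Z, ¬ P.Free Z) (h : Free X (msubst σ T)) :
    Free X T ∧ σ X = none := by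
  induction T generalizing σ with
  | nil => exact h.elim
  | var Y =>
    cases h' : σ Y with
    | none =>
      simp only [msubst, h', Option.getD_none, Free] at h
      subst h; exact ⟨rfl, h'⟩
    | some P =>
      simp only [msubst, h', Option.getD_some] at h
      exact (hσ Y P h' X h).elim
  | sum n α T ih => obtain ⟨i, hi⟩ := h; exact ⟨⟨i, (ih i hσ hi).1⟩, (ih i hσ hi).2⟩
  | prob n w T ih => obtain ⟨i, hi⟩ := h; exact ⟨⟨i, (ih i hσ hi).1⟩, (ih i hσ hi).2⟩
  | mu Y T ih =>
    have h2 := ih (σ := Function.update σ Y none) (fun Z P hZ => by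
      by_cases e : Z = Y
      · subst e; simp at hZ
      · rw [Function.update_of_ne e] at hZ; exact hσ Z P hZ) h.2
    refine ⟨⟨h.1, h2.1⟩, ?_⟩
    rw [← h2.2, Function.update_of_ne (Ne.symm h.1)]

/-- The pairs of a subterm occurrence and the closed terms that its free variables stand for. -/
inductive Conf : Term 𝒜 → (ℕ → Option (Term 𝒜)) → Term 𝒜 → (ℕ → Option (Term 𝒜)) → Prop
  | refl (T : Term 𝒜) (σ) : Conf T σ T σ
  | sum (n : ℕ) (α : Fin (n + 1) → Act 𝒜) (T : Fin (n + 1) → Term 𝒜) (i : Fin (n + 1)) (σ U θ) :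
      Conf (T i) σ U θ → Conf (.sum n α T) σ U θ
  | prob (n : ℕ) (w : Weights (n + 2)) (T : Fin (n + 2) → Term 𝒜) (i : Fin (n + 2)) (σ U θ) :
      Conf (T i) σ U θ → Conf (.prob n w T) σ U θ
  | mu (X : ℕ) (T : Term 𝒜) (σ U θ) :
      Conf T (Function.update σ X (some (msubst σ (.mu X T)))) U θ → Conf (.mu X T) σ U θ

theorem Conf.trans {T U V : Term 𝒜} {σ θ η : ℕ → Option (Term 𝒜)} (h : Conf T σ U θ)
    (h' : Conf U θ V η) : Conf T σ V η := by
  induction h with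
  | refl => exact h'
  | sum n α T i σ U θ _ ih => exact .sum _ _ _ i _ _ _ (ih h')
  | prob n α T i σ U θ _ ih => exact .prob _ _ _ i _ _ _ (ih h')
  | mu X T σ U θ _ ih => exact .mu _ _ _ _ _ (ih h')

/-- Each move to an immediate subterm determines the new environment, so there are at most as many
configurations as subterm occurrences. -/
theorem finite_conf (T : Term 𝒜) (σ : ℕ → Option (Term 𝒜)) :
    {c : Term 𝒜 × (ℕ → Option (Term 𝒜)) | Conf T σ c.1 c.2}.Finite := by
  induction T generalizing σ with
  | nil =>
    refine (Set.finite_singleton (nil, σ)).subset ?_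
    rintro ⟨U, θ⟩ h; cases h; rfl
  | var Y =>
    refine (Set.finite_singleton (var Y, σ)).subset ?_
    rintro ⟨U, θ⟩ h; cases h; rfl
  | sum n α T ih =>
    refine ((Set.finite_singleton (sum n α T, σ)).union
      (Set.finite_iUnion fun i => ih i σ)).subset ?_
    rintro ⟨U, θ⟩ h
    cases h with
    | refl => exact .inl rfl
    | sum _ _ _ i _ _ _ h => exact .inr (Set.mem_iUnion.2 ⟨i, h⟩)
  | prob n α T ih =>
    refine ((Set.finite_singleton (prob n α T, σ)).union
      (Set.finite_iUnion fun i => ih i σ)).subset ?_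
    rintro ⟨U, θ⟩ h
    cases h with
    | refl => exact .inl rfl
    | prob _ _ _ i _ _ _ h => exact .inr (Set.mem_iUnion.2 ⟨i, h⟩)
  | mu X T ih =>
    refine ((Set.finite_singleton (mu X T, σ)).union
      (ih (Function.update σ X (some (msubst σ (.mu X T)))))).subset ?_
    rintro ⟨U, θ⟩ h
    cases h with
    | refl => exact .inl rfl
    | mu _ _ _ _ _ h => exact .inr h

/-- The values of `σ` are closed and foldings of configurations of `T₀`, and the free variables
of `T` lie in the domain of `σ`. -/
structure GoodEnv (T₀ T : Term 𝒜) (σ : ℕ → Option (Term 𝒜)) : Prop where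
  closed : ∀ Y P, σ Y = some P → ∀ Z, ¬ P.Free Z
  dom : ∀ X, Free X T → σ X ≠ none
  conf : ∀ Y P, σ Y = some P → ∃ X U θ, Conf T₀ (fun _ => none) (.mu X U) θ ∧ msubst θ (.mu X U) = P

theorem GoodEnv.of_conf {T₀ T U : Term 𝒜} {σ θ : ℕ → Option (Term 𝒜)} (h : Conf T σ U θ)
    (h₀ : Conf T₀ (fun _ => none) T σ) (hg : GoodEnv T₀ T σ) : GoodEnv T₀ U θ := by
  induction h with
  | refl => exact hg
  | sum n α T i σ U θ _ ih =>
    exact ih (h₀.trans (.sum _ _ _ i _ _ _ (.refl _ _)))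
      ⟨hg.1, fun X hX => hg.2 X ⟨i, hX⟩, hg.3⟩
  | prob n α T i σ U θ _ ih =>
    exact ih (h₀.trans (.prob _ _ _ i _ _ _ (.refl _ _)))
      ⟨hg.1, fun X hX => hg.2 X ⟨i, hX⟩, hg.3⟩
  | mu X T σ U θ _ ih =>
    refine ih (h₀.trans (.mu _ _ _ _ _ (.refl _ _))) ⟨fun Y P hY => ?_, fun Y hY => ?_,
      fun Y P hY => ?_⟩
    · by_cases e : Y = X
      · subst e
        simp only [Function.update_self, Option.some.injEq] at hY
        subst hY
        intro Z hZ
        have := free_msubst hg.1 hZ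
        exact hg.2 Z this.1 this.2
      · rw [Function.update_of_ne e] at hY; exact hg.1 Y P hY
    · by_cases e : Y = X
      · subst e; simp
      · rw [Function.update_of_ne e]; exact hg.2 Y ⟨Ne.symm e, hY⟩
    · by_cases e : Y = X
      · subst e
        simp only [Function.update_self, Option.some.injEq] at hY
        exact ⟨Y, T, σ, h₀, hY⟩
      · rw [Function.update_of_ne e] at hY; exact hg.3 Y P hY

/-- A transition moves from a subterm of `T₀` to a subterm of `T₀`, and unfolding only extends the
environment. Hence all derivatives of `T₀` are instances of its finitely many configurations. -/
theorem Step.exists_conf {T₀ S S' : Term 𝒜} {l : Label 𝒜} (h₀ : ∀ X, ¬ T₀.Free X)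
    (h : Step S l S') {T : Term 𝒜} {σ : ℕ → Option (Term 𝒜)}
    (hT : Conf T₀ (fun _ => none) T σ) (hS : msubst σ T = S) :
    ∃ U θ, Conf T₀ (fun _ => none) U θ ∧ msubst θ U = S' := by
  have good : ∀ {T σ}, Conf T₀ (fun _ => none) T σ → GoodEnv T₀ T σ := fun h =>
    GoodEnv.of_conf h (.refl _ _) ⟨by simp, fun X hX => (h₀ X hX).elim, by simp⟩
  -- A variable stands for a fixpoint recorded in the environment, which is itself an instance of a
  -- configuration and can replace it.
  have key : ∀ Y, T = var Y → ∃ X U θ, Conf T₀ (fun _ => none) (.mu X U) θ ∧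
      msubst θ (.mu X U) = S := by
    rintro Y rfl
    cases e : σ Y with
    | none => simp only [msubst, e, Option.getD_none] at hS; subst hS; cases h
    | some P =>
      simp only [msubst, e, Option.getD_some] at hS; subst hS
      exact (good hT).3 Y P e
  induction h generalizing T σ with
  | sum n α V i =>
    cases T with
    | nil => cases hS
    | var Y => obtain ⟨X, U, θ, _, h⟩ := key Y rfl; cases h
    | sum m β T => cases hS; exact ⟨T i, σ, hT.trans (.sum _ _ _ i _ _ _ (.refl _ _)), rfl⟩
    | prob m β T => cases hS
    | mu Y T => cases hS
  | prob n α V i =>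
    cases T with
    | nil => cases hS
    | var Y => obtain ⟨X, U, θ, _, h⟩ := key Y rfl; cases h
    | sum m β T => cases hS
    | prob m β T => cases hS; exact ⟨T i, σ, hT.trans (.prob _ _ _ i _ _ _ (.refl _ _)), rfl⟩
    | mu Y T => cases hS
  | mu Z V l S' hstep ih =>
    -- Unfolding an instance of a fixpoint amounts to entering its body with the bound variable
    -- mapped to the folded instance.
    have main : ∀ X U θ, Conf T₀ (fun _ => none) (.mu X U) θ → msubst θ (.mu X U) = .mu Z V →
        ∃ U θ, Conf T₀ (fun _ => none) U θ ∧ msubst θ U = S' := by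
      intro X U θ hc he
      have hc' : Conf T₀ (fun _ => none) U
          (Function.update θ X (some (msubst θ (.mu X U)))) :=
        hc.trans (.mu _ _ _ _ _ (.refl _ _))
      have e : msubst (Function.update θ X (some (msubst θ (.mu X U)))) U
          = subst Z (.mu Z V) V := by
        rw [← he]
        simp only [msubst, mu.injEq] at he
        obtain ⟨rfl, rfl⟩ := he
        rw [subst_msubst]
        · simp [msubst]
        · intro Y P hY
          by_cases e : Y = X
          · subst e; simp at hY
          · rw [Function.update_of_ne e] at hY; exact (good hc).1 Y P hY
        · simp
      refine ih hc' e ?_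
      -- The body may itself be a variable; its value is then again a fixpoint configuration, and
      -- `key` holds for it.
      rintro Y rfl
      have g := good hc'
      cases e' : Function.update θ X (some (msubst θ (.mu X (.var Y)))) Y with
      | none => exact (g.2 Y rfl e').elim
      | some P =>
        obtain ⟨X', U', θ', h1, h2⟩ := g.3 Y P e'
        refine ⟨X', U', θ', h1, ?_⟩
        rw [h2, ← e]; simp only [msubst] at e' ⊢; rw [e']; rfl
    cases T with
    | nil => cases hS
    | var Y => obtain ⟨X, U, θ, h1, h2⟩ := key Y rfl; exact main X U θ h1 h2
    | sum m β T => cases hS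
    | prob m β T => cases hS
    | mu Y T => exact main Y T σ hT hS

end Term

theorem finite_reachable (A : Proc 𝒜) : {B | Reachable A B}.Finite := by
  have h : ∀ B, Reachable A B → ∃ U θ, Term.Conf A.1 (fun _ => none) U θ ∧ Term.msubst θ U = B.1 := by
    intro B hB
    induction hB with
    | refl => exact ⟨A.1, _, .refl _ _, Term.msubst_none _⟩
    | tail _ h ih =>
      obtain ⟨l, h⟩ := h
      obtain ⟨U, θ, h1, h2⟩ := ih
      exact Term.Step.exists_conf A.2.2 h h1 h2
  have hf := (Term.finite_conf A.1 (fun _ => none)).image fun c => Term.msubst c.2 c.1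
  refine (hf.preimage (f := Subtype.val) (Subtype.val_injective.injOn)).subset ?_
  intro B hB
  obtain ⟨U, θ, h1, h2⟩ := h B hB
  exact ⟨(U, θ), h1, h2⟩

/-! Transitions of processes. -/

theorem Label.silent_tau : (Label.act .tau : Label 𝒜).Silent := trivial

theorem Label.silent_ptau {p : ℝ} {hp : 0 < p ∧ p < 1} : (Label.ptau p hp : Label 𝒜).Silent :=
  trivial

namespace Proc

variable {A A' : Proc 𝒜} {n : ℕ} {w : Weights (n + 2)} {P : Fin (n + 2) → Proc 𝒜}

theorem CollStep.step (h : A.CollStep n w P) (i : Fin (n + 2)) :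
    A.Step (.ptau (w.p i) (w.mem i)) (P i) :=
  Term.CollStep.step h i

theorem Step.exists_collStep {p : ℝ} {hp : 0 < p ∧ p < 1} (h : A.Step (.ptau p hp) A') :
    ∃ (n : ℕ) (w : Weights (n + 2)) (P : Fin (n + 2) → Proc 𝒜) (i : Fin (n + 2)),
      A.CollStep n w P ∧ w.p i = p ∧ P i = A' := by
  obtain ⟨n, w, P, i, h1, h2, h3⟩ := Term.Step.exists_collStep h
  exact ⟨n, w, fun i => ⟨P i, (h1.step i).isProc A.2⟩, i, h1, h2, Subtype.ext h3⟩

theorem CollStep.not_act {α : Act 𝒜} (h : A.CollStep n w P) : ¬ A.Step (.act α) A' :=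
  Term.CollStep.not_act h

theorem CollStep.unique {m : ℕ} {v : Weights (m + 2)} {Q : Fin (m + 2) → Proc 𝒜}
    (h : A.CollStep n w P) (h' : A.CollStep m v Q) : n = m ∧ w ≍ v ∧ P ≍ Q := by
  obtain ⟨rfl, hw, hP⟩ := Term.CollStep.unique h h'
  refine ⟨rfl, hw, heq_of_eq ?_⟩
  ext1 i
  exact Subtype.ext (congrFun (eq_of_heq hP) i)

/-- The term underlying a process. -/
def term (A : Proc 𝒜) : Term 𝒜 := A.1

theorem term_injective : Function.Injective (term (𝒜 := 𝒜)) := fun _ _ h => Subtype.ext h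

theorem PStep_iff {α : Act 𝒜} {ρ : PMF (Proc 𝒜)} :
    A.PStep α ρ ↔ Term.PStep A.term α (ρ.map term) := Iff.rfl

theorem Step.pStep {α : Act 𝒜} (h : A.Step (.act α) A') : A.PStep α (PMF.pure A') := by
  have := Term.Step.pStep h
  rwa [PStep_iff, PMF.pure_map]

theorem CollStep.pStep (h : A.CollStep n w P) : A.PStep .tau (w.dist.map P) := by
  have := Term.CollStep.pStep h
  rwa [PStep_iff, PMF.map_comp]

/-- Transitions of processes are defined through push-forwards to terms; injectivity recovers the
distribution on processes. -/
theorem map_term_injective : Function.Injective (fun ρ : PMF (Proc 𝒜) => ρ.map term) := by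
  intro ρ ρ' h
  ext A
  have h' := DFunLike.congr_fun h A.term
  have : ∀ ρ : PMF (Proc 𝒜), (ρ.map term) A.term = ρ A := by
    intro ρ
    rw [PMF.map_apply, tsum_eq_single A]
    · simp
    · intro B hB
      rw [if_neg fun e => hB (term_injective e.symm)]
  simpa only [this] using h'

theorem PStep.cases' {α : Act 𝒜} {ρ : PMF (Proc 𝒜)} (h : A.PStep α ρ) :
    (∃ A', A.Step (.act α) A' ∧ ρ = PMF.pure A') ∨
    (α = .tau ∧ ∃ (n : ℕ) (w : Weights (n + 2)) (P : Fin (n + 2) → Proc 𝒜),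
      A.CollStep n w P ∧ ρ = w.dist.map P) := by
  rcases Term.PStep.cases' h with ⟨T', h1, h2⟩ | ⟨e, n, w, P, h1, h2⟩
  · refine .inl ⟨⟨T', h1.isProc A.2⟩, h1, map_term_injective (h2.trans ?_)⟩
    exact (PMF.pure_map term (⟨T', h1.isProc A.2⟩ : Proc 𝒜)).symm
  · refine .inr ⟨e, n, w, fun i => ⟨P i, (h1.step i).isProc A.2⟩, h1, map_term_injective (h2.trans ?_)⟩
    exact (PMF.map_comp (fun i => (⟨P i, (h1.step i).isProc A.2⟩ : Proc 𝒜)) w.dist term).symm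

end Proc

theorem Weights.dist_apply {n : ℕ} (w : Weights n) (i : Fin n) :
    w.dist i = ENNReal.ofReal (w.p i) := rfl

theorem SilentReachable.reachable {A B : Proc 𝒜} (h : SilentReachable A B) : Reachable A B :=
  Relation.ReflTransGen.mono (fun _ _ ⟨l, h⟩ => ⟨l, h.2⟩) _ _ h

theorem SilentReachable.tail {A B C : Proc 𝒜} {l : Label 𝒜} (h : SilentReachable A B)
    (hl : l.Silent) (h' : B.Step l C) : SilentReachable A C :=
  Relation.ReflTransGen.tail h ⟨l, hl, h'⟩

/-! ### Silent transitions and epsilon-trees -/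

/-- `A` has a silent transition all of whose branches end in `S`. -/
def SilentInto (S : Set (Proc 𝒜)) (A : Proc 𝒜) : Prop :=
  (∃ A' ∈ S, A.Step (.act .tau) A') ∨
  ∃ (n : ℕ) (w : Weights (n + 2)) (P : Fin (n + 2) → Proc 𝒜), A.CollStep n w P ∧ ∀ i, P i ∈ S

theorem SilentInto.mono {S S' : Set (Proc 𝒜)} {A : Proc 𝒜} (h : SilentInto S A)
    (hS : ∀ B ∈ S, SilentReachable A B → B ∈ S') : SilentInto S' A := by
  rcases h with ⟨A', h, h'⟩ | ⟨n, w, P, h, h'⟩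
  · exact .inl ⟨A', hS A' h (.single ⟨_, Label.silent_tau, h'⟩), h'⟩
  · exact .inr ⟨n, w, P, h, fun i => hS _ (h' i) (.single ⟨_, Label.silent_ptau, h.step i⟩)⟩

namespace EpsTree

variable {E : Setoid (Proc 𝒜)} {A : Proc 𝒜} (t : EpsTree E A)

/-- The tree that consists of its root. -/
def trivialTree (E : Setoid (Proc 𝒜)) (A : Proc 𝒜) : EpsTree E A where
  arity _ := 0
  lab _ := A
  edge _ := 1
  IsNode u := u = []
  isNode_nil := rfl
  isNode_cons := by simp
  lab_root := rfl
  lab_mem _ _ := E.refl' A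
  children _ _ := .inl rfl

theorem trivialTree_isLeaf {u : List ℕ} : (trivialTree E A).IsLeaf u ↔ u = [] := by
  simp [IsLeaf, trivialTree]

theorem trivialTree_regular : (trivialTree E A).Regular := by
  have h : (trivialTree E A).convProb = fun _ => 1 := by
    ext1 k
    rw [convProb, tsum_eq_single ⟨[], trivialTree_isLeaf.2 rfl, by simp⟩]
    · simp [pathProb]
    · rintro ⟨u, hu, _⟩ h
      exact (h (Subtype.ext (trivialTree_isLeaf.1 hu))).elim
  rw [Regular, h]
  exact tendsto_const_nhds

theorem silentInto {u : List ℕ} (hu : t.IsNode u) (h : t.arity u ≠ 0) :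
    SilentInto {B | ∃ i, t.IsNode (i :: u) ∧ t.lab (i :: u) = B} (t.lab u) := by
  rcases t.children u hu with h0 | ⟨h1, hs, _⟩ | ⟨n, w, hn, hs, _⟩
  · exact (h h0).elim
  · exact .inl ⟨_, ⟨0, (t.isNode_cons _ _).2 ⟨hu, by omega⟩, rfl⟩, hs⟩
  · exact .inr ⟨n, w, _, hs, fun i => ⟨i, (t.isNode_cons _ _).2 ⟨hu, by omega⟩, rfl⟩⟩

theorem step_child {i : ℕ} {u : List ℕ} (h : t.IsNode (i :: u)) :
    0 < t.edge (i :: u) ∧ ∃ l : Label 𝒜, l.Silent ∧ (t.lab u).Step l (t.lab (i :: u)) := by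
  obtain ⟨hu, hi⟩ := (t.isNode_cons _ _).1 h
  rcases t.children u hu with h0 | ⟨h1, hs, he⟩ | ⟨n, w, hn, hs, he⟩
  · omega
  · obtain rfl : i = 0 := by omega
    exact ⟨by simp [he], _, Label.silent_tau, hs⟩
  · have := he ⟨i, by omega⟩
    simp only at this
    exact ⟨this ▸ (w.mem _).1, _, Label.silent_ptau, hs.step ⟨i, by omega⟩⟩

theorem silentReachable {u : List ℕ} (h : t.IsNode u) : SilentReachable A (t.lab u) := by
  induction u with
  | nil => rw [t.lab_root]; exact .refl
  | cons i u ih =>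
    obtain ⟨_, l, hl, hs⟩ := t.step_child h
    exact (ih ((t.isNode_cons _ _).1 h).1).tail hl hs

theorem pathProb_pos {u : List ℕ} (h : t.IsNode u) : 0 < t.pathProb u := by
  induction u with
  | nil => exact one_pos
  | cons i u ih => exact mul_pos (t.step_child h).1 (ih ((t.isNode_cons _ _).1 h).1)

variable {t}

/-- One leaf is all that is extracted from regularity: the bisimulation condition is available at
every process of the class, so a tree need not be followed to all its leaves at once. -/
theorem Regular.exists_leaf (h : t.Regular) : ∃ u, t.IsLeaf u := by
  by_contra hn
  push Not at hn
  have : t.convProb = fun _ => 0 := by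
    ext1 k
    rw [convProb, ENNReal.tsum_eq_zero]
    exact fun u => (hn u.1 u.2.1).elim
  rw [Regular, this] at h
  exact zero_ne_one (tendsto_nhds_unique tendsto_const_nhds h)

/-- A leaf is reached with positive probability and counts in every sufficiently late partial sum,
so the limit is zero only without leaves. Divergence thus becomes a property of the tree's shape. -/
theorem divergent_iff : t.Divergent ↔ ∀ u, ¬ t.IsLeaf u := by
  refine ⟨fun h u hu => ?_, fun h => ?_⟩
  · have h1 : ∀ᶠ k in Filter.atTop, ENNReal.ofReal (t.pathProb u) ≤ t.convProb k := by
      filter_upwards [Filter.eventually_ge_atTop u.length] with k hk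
      exact ENNReal.le_tsum (f := fun v : {v : List ℕ // t.IsLeaf v ∧ v.length ≤ k} =>
        ENNReal.ofReal (t.pathProb v.1)) ⟨u, hu, hk⟩
    have := ge_of_tendsto h h1
    simp only [nonpos_iff_eq_zero, ENNReal.ofReal_eq_zero] at this
    exact this.not_gt (t.pathProb_pos hu.1)
  · have : t.convProb = fun _ => 0 := by
      ext1 k
      rw [convProb, ENNReal.tsum_eq_zero]
      exact fun u => (h u.1 u.2.1).elim
    rw [Divergent, this]
    exact tendsto_const_nhds

end EpsTree

/-! ### Local criteria for branching bisimulations and transfer of silent reachability -/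

section

variable {E : Setoid (Proc 𝒜)} {A B : Proc 𝒜} {C : Quotient E}

theorem EllTrans.of_step {l : Act 𝒜} {A' : Proc 𝒜} (h : A.Step (.act l) A')
    (hC : Quotient.mk E A' = C) : EllTrans E A l C := by
  refine ⟨.trivialTree E A, EpsTree.trivialTree_regular, fun u _ => ⟨A', h, hC⟩⟩

/-- The leaf condition of a `q`-transition. -/
def CollTo (E : Setoid (Proc 𝒜)) (q : ℝ) (C : Quotient E) (A : Proc 𝒜) : Prop :=
  ∃ (n : ℕ) (w : Weights (n + 2)) (P : Fin (n + 2) → Proc 𝒜), A.CollStep n w P ∧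
    arrive E w P (Quotient.mk E A) < 1 ∧
    arrive E w P C / (1 - arrive E w P (Quotient.mk E A)) = q

theorem QTrans.of_collTo {q : ℝ} (h : CollTo E q C A) : QTrans E A q C :=
  ⟨.trivialTree E A, EpsTree.trivialTree_regular, fun _ _ => h⟩

/-- A leaf of a tree of `A` is in the class of `A` and performs the final transition itself, so it
suffices to match single transitions of all members of the class. -/
theorem isBranchingBisim_of_local
    (h₁ : ∀ A B, E.r A B → ∀ l A', ((∃ a, l = .ext a) ∨ (l = .tau ∧ ¬ E.r A' A)) →
      A.Step (.act l) A' → EllTrans E B l (Quotient.mk E A'))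
    (h₂ : ∀ A B, E.r A B → ∀ q C, C ≠ Quotient.mk E A → CollTo E q C A → QTrans E B q C) :
    IsBranchingBisim E := by
  refine fun A B hAB C => ⟨fun l hl ⟨t, ht, hleaf⟩ => ?_, fun q hC ⟨t, ht, hleaf⟩ => ?_⟩
  · obtain ⟨u, hu⟩ := ht.exists_leaf
    obtain ⟨A', hs, rfl⟩ := hleaf u hu
    have hA := t.lab_mem u hu.1
    refine h₁ _ _ (E.trans' hA hAB) l A' (hl.imp_right fun h => ⟨h.1, fun h' => h.2 ?_⟩) hs
    exact Quotient.sound (E.trans' h' hA)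
  · obtain ⟨u, hu⟩ := ht.exists_leaf
    have hA := t.lab_mem u hu.1
    refine h₂ _ _ (E.trans' hA hAB) q C ?_ (hleaf u hu)
    rwa [Quotient.sound hA]

variable {n : ℕ} (w : Weights n) (P : Fin n → Proc 𝒜)

theorem arrive_nonneg (C : Quotient E) : 0 ≤ arrive E w P C := by
  refine Finset.sum_nonneg fun i _ => ?_
  split_ifs
  · exact (w.mem i).1.le
  · exact le_rfl

theorem arrive_pos_iff : 0 < arrive E w P C ↔ ∃ i, Quotient.mk E (P i) = C := by
  classical
  constructor
  · intro h
    by_contra hn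
    push Not at hn
    rw [arrive, Finset.sum_eq_zero fun i _ => if_neg (hn i)] at h
    exact h.false
  · rintro ⟨i, hi⟩
    refine Finset.sum_pos' (fun j _ => ?_) ⟨i, Finset.mem_univ i, ?_⟩
    · split_ifs
      · exact (w.mem j).1.le
      · exact le_rfl
    · simp [hi, (w.mem i).1]

theorem arrive_lt_one_iff : arrive E w P C < 1 ↔ ∃ i, Quotient.mk E (P i) ≠ C := by
  classical
  constructor
  · intro h
    by_contra hn
    push Not at hn
    rw [arrive, Finset.sum_congr rfl fun i _ => if_pos (hn i), w.sum_eq_one] at h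
    exact h.false
  · rintro ⟨i, hi⟩
    rw [← w.sum_eq_one]
    refine Finset.sum_lt_sum (fun j _ => ?_) ⟨i, Finset.mem_univ i, ?_⟩
    · split_ifs
      · exact le_rfl
      · exact (w.mem j).1.le
    · simp [hi, (w.mem i).1]

end

section

variable {E : Setoid (Proc 𝒜)} {A B : Proc 𝒜}

theorem collTo_of_collStep {n : ℕ} {w : Weights (n + 2)} {P : Fin (n + 2) → Proc 𝒜}
    (h : A.CollStep n w P) {i : Fin (n + 2)} (hi : ¬ E.r (P i) A) (C : Quotient E) :
    CollTo E (arrive E w P C / (1 - arrive E w P (Quotient.mk E A))) C A :=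
  ⟨n, w, P, h, (arrive_lt_one_iff w P).2 ⟨i, fun e => hi (Quotient.exact e)⟩, rfl⟩

/-- A process whose collective silent transition may leave its class only has trivial trees. -/
theorem QTrans.collTo_of_collStep {q : ℝ} {C : Quotient E} (h : QTrans E A q C)
    {n : ℕ} {w : Weights (n + 2)} {P : Fin (n + 2) → Proc 𝒜}
    (hs : A.CollStep n w P) {i : Fin (n + 2)} (hi : ¬ E.r (P i) A) : CollTo E q C A := by
  obtain ⟨t, ht, hleaf⟩ := h
  have hroot := t.lab_root
  by_cases h0 : t.arity [] = 0
  · have := hleaf [] ⟨t.isNode_nil, h0⟩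
    rwa [hroot] at this
  -- A root with children would have all the targets `P` as children, by uniqueness, and `P i` would
  -- be in the class of `A`.
  · exfalso
    rcases t.silentInto t.isNode_nil h0 with ⟨A', _, h'⟩ | ⟨m, v, Q, h', hQ⟩
    · rw [hroot] at h'; exact hs.not_act h'
    · rw [hroot] at h'
      obtain ⟨rfl, -, hP⟩ := hs.unique h'
      obtain rfl := eq_of_heq hP
      obtain ⟨j, hj, e⟩ := hQ i
      exact hi (e ▸ t.lab_mem _ hj)

theorem CollTo.eq_of_collStep {q : ℝ} {C : Quotient E} (h : CollTo E q C A)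
    {n : ℕ} {w : Weights (n + 2)} {P : Fin (n + 2) → Proc 𝒜} (hs : A.CollStep n w P) :
    q = arrive E w P C / (1 - arrive E w P (Quotient.mk E A)) := by
  obtain ⟨m, v, Q, h', _, e⟩ := h
  obtain ⟨rfl, hw, hP⟩ := hs.unique h'
  obtain rfl := eq_of_heq hP
  obtain rfl := eq_of_heq hw
  exact e.symm

/-- Related processes with collective transitions that may leave their class agree on the
conditional probabilities. -/
theorem IsBranchingBisim.arrive_eq (hE : IsBranchingBisim E) (hAB : E.r A B)
    {n m : ℕ} {w : Weights (n + 2)} {P : Fin (n + 2) → Proc 𝒜}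
    {v : Weights (m + 2)} {Q : Fin (m + 2) → Proc 𝒜}
    (hA : A.CollStep n w P) {i : Fin (n + 2)} (hi : ¬ E.r (P i) A)
    (hB : B.CollStep m v Q) {j : Fin (m + 2)} (hj : ¬ E.r (Q j) B)
    {C : Quotient E} (hC : C ≠ Quotient.mk E A) :
    arrive E w P C / (1 - arrive E w P (Quotient.mk E A)) =
      arrive E v Q C / (1 - arrive E v Q (Quotient.mk E B)) :=
  (((hE A B hAB C).2 _ hC (.of_collTo (collTo_of_collStep hA hi C))).collTo_of_collStep
    hB hj).eq_of_collStep hB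

theorem IsBranchingBisim.exists_silentReachable_of_step (hE : IsBranchingBisim E)
    (hAB : E.r A B) {A' : Proc 𝒜} {l : Label 𝒜} (hl : l.Silent) (h : A.Step l A') :
    ∃ B', SilentReachable B B' ∧ E.r A' B' := by
  by_cases hA' : E.r A' A
  · exact ⟨B, .refl, E.trans' hA' hAB⟩
  have hC : Quotient.mk E A' ≠ Quotient.mk E A := fun e => hA' (Quotient.exact e)
  match l, hl, h with
  | .act .tau, _, h =>
    obtain ⟨t, ht, hleaf⟩ := (hE A B hAB (Quotient.mk E A')).1 .tau (.inr ⟨rfl, hC⟩)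
      (.of_step h rfl)
    obtain ⟨u, hu⟩ := ht.exists_leaf
    obtain ⟨B', hs, e⟩ := hleaf u hu
    exact ⟨B', (t.silentReachable hu.1).tail Label.silent_tau hs, E.symm' (Quotient.exact e)⟩
  | .ptau p hp, _, h =>
    obtain ⟨n, w, P, i, hs, -, rfl⟩ := h.exists_collStep
    obtain ⟨t, ht, hleaf⟩ := (hE A B hAB (Quotient.mk E (P i))).2 _ hC
      (.of_collTo (collTo_of_collStep hs hA' _))
    obtain ⟨u, hu⟩ := ht.exists_leaf
    obtain ⟨m, v, Q, h1, h2, h3⟩ := hleaf u hu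
    -- The conditional probability of the class of `P i` is positive for `A`, so the equal one at
    -- the leaf is not zero.
    have hpos : 0 < arrive E v Q (Quotient.mk E (P i)) := by
      refine lt_of_le_of_ne (arrive_nonneg _ _ _) fun e => ?_
      rw [← e, zero_div, eq_comm, div_eq_zero_iff] at h3
      rcases h3 with h3 | h3
      · exact ((arrive_pos_iff w P).2 ⟨i, rfl⟩).ne' h3
      · have := (arrive_lt_one_iff (C := Quotient.mk E A) w P).2 ⟨i, hC⟩
        linarith
    obtain ⟨j, hj⟩ := (arrive_pos_iff v Q).1 hpos
    exact ⟨Q j, (t.silentReachable hu.1).tail Label.silent_ptau (h1.step j), E.symm' (Quotient.exact hj)⟩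

theorem IsBranchingBisim.exists_silentReachable (hE : IsBranchingBisim E)
    (hAB : E.r A B) {A' : Proc 𝒜} (h : SilentReachable A A') :
    ∃ B', SilentReachable B B' ∧ E.r A' B' := by
  induction h with
  | refl => exact ⟨B, .refl, hAB⟩
  | tail _ h ih =>
    obtain ⟨l, hl, h⟩ := h
    obtain ⟨B', h1, h2⟩ := ih
    obtain ⟨B'', h3, h4⟩ := hE.exists_silentReachable_of_step h2 hl h
    exact ⟨B'', h1.trans h3, h4⟩

end

/-! ### End components and divergence -/

/-- The source of an edge of an end component has a silent transition all of whose branches stay in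
the end component. -/
theorem IsTauEC.silentInto {A C : Proc 𝒜} {g : Graph 𝒜} (h : IsTauEC A g) {l : Label 𝒜}
    {D : Proc 𝒜} (hC : (C, l, D) ∈ g.E) : SilentInto g.V C := by
  match l, h.silent _ _ _ hC, hC with
  | .act .tau, _, hC => exact .inl ⟨D, (h.edge _ _ _ hC).2.1, (h.edge _ _ _ hC).2.2⟩
  | .ptau p hp, _, hC =>
    obtain ⟨n, w, P, hs, _, hP⟩ := h.closed _ _ _ _ hC
    exact .inr ⟨n, w, P, hs, fun i => (h.edge _ _ _ (hP i)).2.1⟩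

theorem IsTauEC.exists_edge {A C : Proc 𝒜} {g : Graph 𝒜} (h : IsTauEC A g) (hC : C ∈ g.V) :
    ∃ l D, (C, l, D) ∈ g.E := by
  obtain ⟨⟨C₀, l₀, D₀⟩, h₀⟩ := h.nontrivial
  rcases (h.connected C hC C₀ (h.edge _ _ _ h₀).1).cases_head with rfl | ⟨D, ⟨l, hl⟩, _⟩
  · exact ⟨l₀, D₀, h₀⟩
  · exact ⟨l, D, hl⟩

open Relation in
/-- A finite set in which every process has a silent transition into the set contains a
`τ`-end component. -/
theorem exists_isTauEC {A B : Proc 𝒜} {S : Set (Proc 𝒜)} (hf : S.Finite) (hB : B ∈ S)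
    (hr : ∀ C ∈ S, Reachable A C) (hS : ∀ C ∈ S, SilentInto S C) :
    ∃ g, IsTauEC A g ∧ g.V ⊆ S ∧ g.V.Nonempty := by
  -- One transition is fixed per process, with all its branches as edges, which makes the closure
  -- condition of end components automatic.
  have hout : ∀ C : Proc 𝒜, ∃ out : Set (Label 𝒜 × Proc 𝒜), C ∈ S →
      out.Nonempty ∧ ∀ l D, (l, D) ∈ out → D ∈ S ∧ C.Step l D ∧ l.Silent ∧
        ∀ q hq, l = .ptau q hq → ∃ (n : ℕ) (w : Weights (n + 2)) (P : Fin (n + 2) → Proc 𝒜),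
          C.CollStep n w P ∧ (∃ k, w.p k = q ∧ P k = D) ∧
          ∀ i, (Label.ptau (w.p i) (w.mem i), P i) ∈ out := by
    intro C
    by_cases hC : C ∈ S
    · rcases hS C hC with ⟨D, hD, hs⟩ | ⟨n, w, P, hs, hP⟩
      · refine ⟨{(.act .tau, D)}, fun _ => ⟨Set.singleton_nonempty _, ?_⟩⟩
        rintro l D' h
        obtain ⟨rfl, rfl⟩ := Prod.mk.inj h
        exact ⟨hD, hs, Label.silent_tau, fun q hq h => by cases h⟩
      · refine ⟨Set.range fun i => (Label.ptau (w.p i) (w.mem i), P i), fun _ =>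
          ⟨Set.range_nonempty _, ?_⟩⟩
        rintro l D' ⟨i, h⟩
        obtain ⟨rfl, rfl⟩ := Prod.mk.inj h
        refine ⟨hP i, hs.step i, Label.silent_ptau, fun q hq h => ?_⟩
        cases h
        exact ⟨n, w, P, hs, ⟨i, rfl, rfl⟩, fun j => ⟨j, rfl⟩⟩
    · exact ⟨∅, fun h => (hC h).elim⟩
  choose out hout using hout
  let r : Proc 𝒜 → Proc 𝒜 → Prop := fun C D => ∃ l, (l, D) ∈ out C
  let R : Proc 𝒜 → Set (Proc 𝒜) := fun C => {D | ReflTransGen r C D}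
  have hR : ∀ C ∈ S, R C ⊆ S := by
    intro C hC D hD
    induction hD with
    | refl => exact hC
    | tail _ h ih => obtain ⟨l, h⟩ := h; exact ((hout _ ih).2 _ _ h).1
  -- A vertex that reaches the fewest vertices lies in a bottom strongly connected component, which
  -- is the end component sought.
  obtain ⟨C₀, hC₀, hmin⟩ := Set.exists_min_image S (fun C => (R C).ncard) hf ⟨B, hB⟩
  have hback : ∀ C ∈ R C₀, C₀ ∈ R C := by
    intro C hC
    have hsub : R C ⊆ R C₀ := fun D hD => ReflTransGen.trans hC hD
    have := Set.eq_of_subset_of_ncard_le hsub (hmin C (hR _ hC₀ hC)) (hf.subset (hR _ hC₀))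
    rw [this]
    exact .refl
  let g : Graph 𝒜 := ⟨R C₀, {e | e.1 ∈ R C₀ ∧ e.2 ∈ out e.1}⟩
  have hpath : ∀ C ∈ R C₀, ∀ D, ReflTransGen r C D →
      ReflTransGen (fun C' D' => ∃ l, (C', l, D') ∈ g.E) C D := by
    intro C hC D hD
    induction hD with
    | refl => exact .refl
    | tail h h' ih =>
      obtain ⟨l, h'⟩ := h'
      exact ih.tail ⟨l, ReflTransGen.trans hC h, h'⟩
  refine ⟨g, ⟨fun C hC => hr C (hR _ hC₀ hC), ?_, ?_, ?_, ?_, ?_⟩, hR _ hC₀, C₀, .refl⟩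
  · rintro C l D ⟨hC, hD⟩
    exact ⟨hC, ReflTransGen.tail hC ⟨l, hD⟩, ((hout _ (hR _ hC₀ hC)).2 _ _ hD).2.1⟩
  · obtain ⟨⟨l, D⟩, h⟩ := (hout _ hC₀).1
    exact ⟨(C₀, l, D), .refl, h⟩
  · exact fun C hC D hD => hpath C hC D (ReflTransGen.trans (hback C hC) hD)
  · rintro C l D ⟨hC, hD⟩
    exact ((hout _ (hR _ hC₀ hC)).2 _ _ hD).2.2.1
  · rintro C q hq D ⟨hC, hD⟩
    obtain ⟨n, w, P, h1, h2, h3⟩ := ((hout _ (hR _ hC₀ hC)).2 _ _ hD).2.2.2 q hq rfl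
    exact ⟨n, w, P, h1, h2, fun i => ⟨hC, h3 i⟩⟩

theorem exists_reachesEC {A B : Proc 𝒜} {S : Set (Proc 𝒜)} (hB : B ∈ S)
    (hr : ∀ C ∈ S, SilentReachable A C) (hS : ∀ C ∈ S, SilentInto S C) :
    ∃ g, ReachesEC A g ∧ g.V ⊆ S := by
  obtain ⟨g, hg, hgS, C, hC⟩ := exists_isTauEC
    ((finite_reachable A).subset fun C hC => (hr C hC).reachable) hB
    (fun C hC => (hr C hC).reachable) hS
  exact ⟨g, ⟨hg, C, hr C (hgS hC), hC⟩, hgS⟩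

theorem Diverges.exists_set {E : Setoid (Proc 𝒜)} {A : Proc 𝒜} (h : Diverges E A) :
    ∃ S : Set (Proc 𝒜), A ∈ S ∧ ∀ C ∈ S, SilentReachable A C ∧ E.r C A ∧ SilentInto S C := by
  obtain ⟨t, ht⟩ := h
  rw [EpsTree.divergent_iff] at ht
  refine ⟨{C | ∃ u, t.IsNode u ∧ t.lab u = C}, ⟨[], t.isNode_nil, t.lab_root⟩, ?_⟩
  rintro C ⟨u, hu, rfl⟩
  refine ⟨t.silentReachable hu, t.lab_mem u hu, ?_⟩
  exact (t.silentInto hu fun h0 => ht u ⟨hu, h0⟩).mono fun B ⟨i, hi, e⟩ _ => ⟨_, hi, e⟩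

/-- The nodes of the tree in which the node `C` has the children `child C i`, `i < ar C`. -/
def nodeLabel {α : Type*} (child : α → ℕ → α) (A : α) : List ℕ → α
  | [] => A
  | i :: u => child (nodeLabel child A u) i

def IsTreeNode {α : Type*} (ar : α → ℕ) (child : α → ℕ → α) (A : α) : List ℕ → Prop
  | [] => True
  | i :: u => IsTreeNode ar child A u ∧ i < ar (nodeLabel child A u)

/-- The edge labels of the same tree. -/
def edgeLabel {α : Type*} (child : α → ℕ → α) (pr : α → ℕ → ℝ) (A : α) : List ℕ → ℝ
  | [] => 1
  | i :: u => pr (nodeLabel child A u) i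

/-- Choosing one silent transition in each process of `S` and unfolding from `A` gives a tree
without leaves; `Diverges.exists_set` is the converse. -/
theorem diverges_of_silentInto {E : Setoid (Proc 𝒜)} {A : Proc 𝒜} {S : Set (Proc 𝒜)}
    (hA : A ∈ S) (hS : ∀ C ∈ S, E.r C A ∧ SilentInto S C) : Diverges E A := by
  have hstep : ∀ C : Proc 𝒜, ∃ (ar : ℕ) (ch : ℕ → Proc 𝒜) (pr : ℕ → ℝ), C ∈ S →
      ar ≠ 0 ∧ (∀ i < ar, ch i ∈ S) ∧
      ((ar = 1 ∧ C.Step (.act .tau) (ch 0) ∧ pr 0 = 1) ∨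
      ∃ (n : ℕ) (w : Weights (n + 2)), ar = n + 2 ∧ C.CollStep n w (fun i => ch i) ∧
        ∀ i : Fin (n + 2), pr i = w.p i) := by
    intro C
    by_cases hC : C ∈ S
    · rcases (hS C hC).2 with ⟨D, hD, hs⟩ | ⟨n, w, P, hs, hP⟩
      · exact ⟨1, fun _ => D, fun _ => 1, fun _ =>
          ⟨one_ne_zero, fun _ _ => hD, .inl ⟨rfl, hs, rfl⟩⟩⟩
      · refine ⟨n + 2, fun i => if h : i < n + 2 then P ⟨i, h⟩ else C,
          fun i => if h : i < n + 2 then w.p ⟨i, h⟩ else 0, fun _ =>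
          ⟨by omega, fun i hi => by simp [hi, hP], .inr ⟨n, w, rfl, ?_, ?_⟩⟩⟩
        · simpa using hs
        · simp
    · exact ⟨0, fun _ => C, fun _ => 0, fun h => (hC h).elim⟩
  choose ar ch pr hstep using hstep
  have hnode : ∀ u, IsTreeNode ar ch A u → nodeLabel ch A u ∈ S := by
    intro u
    induction u with
    | nil => exact fun _ => hA
    | cons i u ih => exact fun h => (hstep _ (ih h.1)).2.1 i h.2
  let t : EpsTree E A :=
    { arity := fun u => ar (nodeLabel ch A u)
      lab := nodeLabel ch A
      edge := edgeLabel ch pr A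
      IsNode := IsTreeNode ar ch A
      isNode_nil := trivial
      isNode_cons := fun i u => Iff.rfl
      lab_root := rfl
      lab_mem := fun u hu => (hS _ (hnode u hu)).1
      children := fun u hu => .inr (hstep _ (hnode u hu)).2.2 }
  refine ⟨t, EpsTree.divergent_iff.2 fun u hu => ?_⟩
  exact (hstep _ (hnode u hu.1)).1 hu.2

theorem tauECInvariant_of_forall {E : Setoid (Proc 𝒜)}
    (h : ∀ A B, E.r A B → ∀ g, ReachesEC A g → ∃ g', ReachesEC B g' ∧ RelatedEC E.r g g') :
    TauECInvariant E.r := by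
  refine fun A B hAB => ⟨h A B hAB, fun g hg => ?_⟩
  obtain ⟨g', h1, h2⟩ := h B A (E.symm' hAB) g hg
  refine ⟨g', h1, fun C hC => ?_⟩
  obtain ⟨D, hD, hr⟩ := h2 C hC
  exact ⟨D, hD, E.symm' hr⟩

/-- Along a path from `C` to some process outside the class of `C`, an edge leaves the class. -/
theorem exists_leaving {α : Type*} {E : Setoid α} {r : α → α → Prop} {C D : α}
    (h : Relation.ReflTransGen r C D) (hD : ¬ E.r D C) :
    ∃ C₁ C₂, r C₁ C₂ ∧ E.r C₁ C ∧ ¬ E.r C₂ C := by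
  induction h with
  | refl => exact (hD (E.refl' _)).elim
  | @tail D D' _ h ih =>
    by_cases h' : E.r D C
    · exact ⟨D, D', h, h', hD⟩
    · exact ih h'

/-- A process related to a vertex of an end component that spans several classes has a silent
transition into the classes of the end component. -/
theorem IsBranchingBisim.silentInto {E : Setoid (Proc 𝒜)} (hE : IsBranchingBisim E)
    {A C D C' : Proc 𝒜} {g : Graph 𝒜} (hg : IsTauEC A g) (hC : C ∈ g.V) (hDC : E.r D C)
    (hC' : C' ∈ g.V) (hCC' : ¬ E.r C' C) : SilentInto {D' | ∃ C ∈ g.V, E.r D' C} D := by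
  obtain ⟨C₁, C₂, ⟨l, hedge⟩, h1, h2⟩ := exists_leaving (hg.connected C hC C' hC') hCC'
  have hr : E.r C₁ D := E.trans' h1 (E.symm' hDC)
  have h2' : ¬ E.r C₂ C₁ := fun h => h2 (E.trans' h h1)
  have hne : Quotient.mk E C₂ ≠ Quotient.mk E C₁ := fun e => h2' (Quotient.exact e)
  have hC₁ := (hg.edge _ _ _ hedge).1
  -- If the matching tree goes beyond its root, its first transition already stays in the class of
  -- `C`.
  have root : ∀ t : EpsTree E D, t.arity [] ≠ 0 → SilentInto {D' | ∃ C ∈ g.V, E.r D' C} D := by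
    intro t h0
    have := t.silentInto t.isNode_nil h0
    rw [t.lab_root] at this
    refine this.mono fun B ⟨i, hi, e⟩ _ => ⟨C, hC, E.trans' ?_ hDC⟩
    exact e ▸ t.lab_mem _ hi
  match l, hg.silent _ _ _ hedge, hedge with
  | .act .tau, _, hedge =>
    obtain ⟨t, ht, hleaf⟩ := (hE C₁ D hr (Quotient.mk E C₂)).1 .tau (.inr ⟨rfl, hne⟩)
      (.of_step (hg.edge _ _ _ hedge).2.2 rfl)
    by_cases h0 : t.arity [] = 0
    · obtain ⟨D', hs, e⟩ := hleaf [] ⟨t.isNode_nil, h0⟩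
      rw [t.lab_root] at hs
      exact .inl ⟨D', ⟨C₂, (hg.edge _ _ _ hedge).2.1, Quotient.exact e⟩, hs⟩
    · exact root t h0
  | .ptau p hp, _, hedge =>
    obtain ⟨n, w, P, hs, ⟨k, -, rfl⟩, hP⟩ := hg.closed _ _ _ _ hedge
    obtain ⟨t, ht, hleaf⟩ := (hE C₁ D hr (Quotient.mk E (P k))).2 _ hne
      (.of_collTo (collTo_of_collStep hs h2' _))
    by_cases h0 : t.arity [] = 0
    · obtain ⟨m, v, Q, hs', hlt, -⟩ := hleaf [] ⟨t.isNode_nil, h0⟩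
      rw [t.lab_root] at hs' hlt
      obtain ⟨j, hj⟩ := (arrive_lt_one_iff v Q).1 hlt
      refine .inr ⟨m, v, Q, hs', fun i => ?_⟩
      by_cases hi : E.r (Q i) D
      · exact ⟨C, hC, E.trans' hi hDC⟩
      -- The class of `Q i` has positive conditional probability under `Q`, hence under `P`; all
      -- branches of `P` are vertices of `g` by closure.
      · have hi' : Quotient.mk E (Q i) ≠ Quotient.mk E C₁ := fun e =>
          hi (E.trans' (Quotient.exact e) hr)
        have heq := hE.arrive_eq hr hs h2' hs' hi hi'
        have h3 : 0 < arrive E w P (Quotient.mk E (Q i)) := by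
          refine lt_of_le_of_ne (arrive_nonneg _ _ _) fun e => ?_
          rw [← e, zero_div, eq_comm, div_eq_zero_iff] at heq
          rcases heq with h3 | h3
          · exact ((arrive_pos_iff v Q).2 ⟨i, rfl⟩).ne' h3
          · linarith
        obtain ⟨k', hk'⟩ := (arrive_pos_iff w P).1 h3
        exact ⟨P k', (hg.edge _ _ _ (hP k')).2.1, E.symm' (Quotient.exact hk')⟩
    · exact root t h0

/-- It is enough to find a set of silent derivatives of `B`, related to vertices of `g`, in which
each process has a silent transition into the set: by finiteness it contains an end component. -/
theorem IsBranchingBisim.tauECInvariant {E : Setoid (Proc 𝒜)} (hE : IsBranchingBisim E)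
    (hd : DivPreserving E) : TauECInvariant E.r := by
  refine tauECInvariant_of_forall fun A B hAB g ⟨hg, A', hAA', hA'⟩ => ?_
  obtain ⟨B', hBB', hr⟩ := hE.exists_silentReachable hAB hAA'
  suffices ∃ S : Set (Proc 𝒜), B' ∈ S ∧ ∀ D ∈ S, SilentReachable B D ∧
      (∃ C ∈ g.V, E.r D C) ∧ SilentInto S D by
    obtain ⟨S, hB', hS⟩ := this
    obtain ⟨g', h1, h2⟩ := exists_reachesEC hB' (fun D hD => (hS D hD).1)
      fun D hD => (hS D hD).2.2
    refine ⟨g', h1, fun D hD => ?_⟩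
    obtain ⟨C, hC, h⟩ := (hS D (h2 hD)).2.1
    exact ⟨C, hC, E.symm' h⟩
  -- Divergence preservation is needed only when `g` lies in a single class; otherwise bisimilarity
  -- alone keeps `B` moving.
  by_cases h1 : ∀ C ∈ g.V, E.r C A'
  · have hdiv : Diverges E A' := diverges_of_silentInto hA' fun C hC => by
      obtain ⟨l, D, h⟩ := hg.exists_edge hC
      exact ⟨h1 C hC, hg.silentInto h⟩
    obtain ⟨S, hS, hS'⟩ := ((hd _ _ hr).1 hdiv).exists_set
    refine ⟨S, hS, fun D hD => ?_⟩
    obtain ⟨h2, h3, h4⟩ := hS' D hD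
    exact ⟨hBB'.trans h2, ⟨A', hA', E.trans' h3 (E.symm' hr)⟩, h4⟩
  · push Not at h1
    obtain ⟨C₀, hC₀, hn⟩ := h1
    refine ⟨{D | SilentReachable B D ∧ ∃ C ∈ g.V, E.r D C}, ⟨hBB', A', hA', E.symm' hr⟩, ?_⟩
    rintro D ⟨h2, C, hC, h3⟩
    refine ⟨h2, ⟨C, hC, h3⟩, ?_⟩
    have : SilentInto {D' | ∃ C ∈ g.V, E.r D' C} D := by
      by_cases h4 : E.r C₀ C
      · exact hE.silentInto hg hC h3 hA' fun h => hn (E.trans' h4 (E.symm' h))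
      · exact hE.silentInto hg hC h3 hC₀ h4
    exact this.mono fun D' h h' => ⟨h2.trans h', h⟩

/-! ### Schedulers from strategies: recursion, termination, final distribution -/

/-- The distribution that chooses `x` with probability `w`, and `none` otherwise. -/
noncomputable def mix {α : Type*} (w : ℝ≥0∞) (hw : w ≤ 1) (x : α) : PMF (Option α) :=
  (PMF.ofFintype (fun b : Bool => if b then w else 1 - w) (by simp [hw])).map
    fun b => if b then some x else none

theorem mix_none {α : Type*} {w : ℝ≥0∞} (hw : w ≤ 1) (x : α) : mix w hw x none = 1 - w := by
  simp [mix, PMF.map_apply, tsum_fintype]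

open Classical in
theorem mix_some {α : Type*} {w : ℝ≥0∞} (hw : w ≤ 1) (x y : α) :
    mix w hw x (some y) = if y = x then w else 0 := by
  simp [mix, PMF.map_apply, tsum_fintype]

namespace Frag

def length {A : Proc 𝒜} : {B : Proc 𝒜} → Frag A B → ℕ
  | _, .nil => 0
  | _, .snoc ω _ _ _ => ω.length + 1

theorem trace_snoc {A B C : Proc 𝒜} (ω : Frag A B) (α : Act 𝒜)
    (h : ∃ ρ : PMF (Proc 𝒜), B.PStep α ρ ∧ 0 < ρ C) :
    (ω.snoc α C h).trace = ω.trace ++ α.hat := by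
  cases α with
  | ext a => rfl
  | tau => simp [trace, Act.hat]

/-- A fragment is empty or extends a fragment by a transition. -/
def equivSum (A : Proc 𝒜) :
    Unit ⊕ (Σ ω : (B : Proc 𝒜) × Frag A B,
      {x : Act 𝒜 × Proc 𝒜 // ∃ ρ : PMF (Proc 𝒜), ω.1.PStep x.1 ρ ∧ 0 < ρ x.2}) ≃
    (B : Proc 𝒜) × Frag A B where
  toFun
    | .inl _ => ⟨A, .nil⟩
    | .inr ⟨⟨_, ω⟩, ⟨⟨α, C⟩, h⟩⟩ => ⟨C, ω.snoc α C h⟩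
  invFun
    | ⟨_, .nil⟩ => .inl ()
    | ⟨_, .snoc (B := B) ω α C h⟩ => .inr ⟨⟨B, ω⟩, ⟨⟨α, C⟩, h⟩⟩
  left_inv := by rintro (_ | ⟨⟨B, ω⟩, ⟨⟨α, C⟩, h⟩⟩) <;> rfl
  right_inv := by rintro ⟨_, _ | _⟩ <;> rfl

theorem tsum_eq (A : Proc 𝒜) (f : (B : Proc 𝒜) × Frag A B → ℝ≥0∞) :
    ∑' ω, f ω = f ⟨A, .nil⟩ + ∑' (ω : (B : Proc 𝒜) × Frag A B)
      (x : {x : Act 𝒜 × Proc 𝒜 // ∃ ρ : PMF (Proc 𝒜), ω.1.PStep x.1 ρ ∧ 0 < ρ x.2}),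
      f ⟨x.1.2, ω.2.snoc x.1.1 x.1.2 x.2⟩ := by
  rw [← (equivSum A).tsum_eq, Summable.tsum_sum ENNReal.summable ENNReal.summable, tsum_fintype, Finset.univ_unique,
    Finset.sum_singleton, ENNReal.tsum_sigma']
  rfl

end Frag

/-- A strategy: in the processes of `R` the transition `act D`, `tgt D` is chosen, until `R` is left
or an external action occurs; at the start it is given up with probability `s`. -/
structure Strategy (𝒜 : Type u) where
  R : Set (Proc 𝒜)
  act : Proc 𝒜 → Act 𝒜
  tgt : Proc 𝒜 → PMF (Proc 𝒜)
  pStep : ∀ D ∈ R, D.PStep (act D) (tgt D)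
  s : ℝ≥0∞
  s_le_one : s ≤ 1

namespace Strategy

variable (S : Strategy 𝒜) (B : Proc 𝒜)

open Classical in
/-- The probability that a fragment is continued. -/
noncomputable def weight (n : ℕ) (tr : List 𝒜) (D : Proc 𝒜) : ℝ≥0∞ :=
  if D ∈ S.R ∧ tr = [] then if n = 0 then 1 - S.s else 1 else 0

/-- The strategy goes on after the step from `D` to `D'`. -/
def Next (D D' : Proc 𝒜) : Prop := S.act D = .tau ∧ D' ∈ S.R

theorem weight_le_one (n : ℕ) (tr : List 𝒜) (D : Proc 𝒜) : S.weight n tr D ≤ 1 := by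
  unfold weight
  split_ifs
  · exact tsub_le_self
  · exact le_rfl
  · exact zero_le_one

open Classical in
-- A fragment that is continued has empty trace, so after one more step the trace is `(S.act
-- D).hat`.
theorem weight_succ (n : ℕ) (D D' : Proc 𝒜) :
    S.weight (n + 1) (S.act D).hat D' = if S.Next D D' then 1 else 0 := by
  cases h : S.act D <;> simp [weight, Next, Act.hat, h]

/-- The transition that is chosen in `D`. -/
def tr {D : Proc 𝒜} (h : D ∈ S.R) : Tr D := ⟨(S.act D, S.tgt D), S.pStep D h⟩

open Classical in
noncomputable def sched : Scheduler B := fun D ω =>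
  if h : D ∈ S.R then
    mix (S.weight ω.length ω.trace D) (S.weight_le_one _ _ _) (S.tr h)
  else PMF.pure none

/-- The probability that a fragment is executed and continued. -/
noncomputable def active (ω : (D : Proc 𝒜) × Frag B D) : ℝ≥0∞ :=
  (S.sched B).cone ω.2 * S.weight ω.2.length ω.2.trace ω.1

variable {B}

theorem sched_none {D : Proc 𝒜} (ω : Frag B D) :
    S.sched B D ω none = 1 - S.weight ω.length ω.trace D := by
  by_cases h : D ∈ S.R
  · simp [sched, h, mix_none]
  · simp [sched, weight, h]

theorem mem_of_active_ne_zero {D : Proc 𝒜} {ω : Frag B D} (h : S.active B ⟨D, ω⟩ ≠ 0) :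
    D ∈ S.R ∧ ω.trace = [] := by
  by_contra hn
  exact h (by simp [active, weight, hn])

open Classical in
theorem cone_snoc {D C : Proc 𝒜} (ω : Frag B D) (α : Act 𝒜) (h) :
    (S.sched B).cone (ω.snoc α C h) =
      S.active B ⟨D, ω⟩ * if S.act D = α then S.tgt D C else 0 := by
  rw [Scheduler.cone, active, mul_assoc]
  congr 1
  by_cases hD : D ∈ S.R
  · rw [tsum_eq_single (S.tr hD)]
    · have e : (S.tr hD).1 = (S.act D, S.tgt D) := rfl
      simp [sched, hD, mix_some, e]
    · intro tr htr
      simp [sched, hD, mix_some, htr]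
  · simp [sched, weight, hD]

/-- Every non-empty fragment of positive probability extends an active one by the chosen transition.
The choices of `G` below give the expected number of steps, the total mass and the final
distribution. -/
theorem tsum_cone_mul (G : ℕ → List 𝒜 → Proc 𝒜 → ℝ≥0∞) :
    ∑' ω : (D : Proc 𝒜) × Frag B D, (S.sched B).cone ω.2 * G ω.2.length ω.2.trace ω.1 =
      G 0 [] B + ∑' ω : (D : Proc 𝒜) × Frag B D, S.active B ω *
        ∑' D', S.tgt ω.1 D' * G (ω.2.length + 1) (S.act ω.1).hat D' := by
  classical
  rw [Frag.tsum_eq]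
  congr 1
  · simp [Scheduler.cone, Frag.length, Frag.trace]
  refine tsum_congr fun ⟨D, ω⟩ => ?_
  simp only [cone_snoc]
  by_cases h0 : S.active B ⟨D, ω⟩ = 0
  · simp [h0]
  obtain ⟨hD, htr⟩ := S.mem_of_active_ne_zero h0
  let f : Act 𝒜 × Proc 𝒜 → ℝ≥0∞ := fun x =>
    (S.active B ⟨D, ω⟩ * if S.act D = x.1 then S.tgt D x.2 else 0) *
      G (ω.length + 1) x.1.hat x.2
  have h1 : ∀ x : {x : Act 𝒜 × Proc 𝒜 // ∃ ρ : PMF (Proc 𝒜), D.PStep x.1 ρ ∧ 0 < ρ x.2},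
      (S.active B ⟨D, ω⟩ * if S.act D = x.1.1 then S.tgt D x.1.2 else 0) *
        G (ω.snoc x.1.1 x.1.2 x.2).length (ω.snoc x.1.1 x.1.2 x.2).trace x.1.2 = f x.1 := by
    intro x
    rw [Frag.trace_snoc, htr]
    rfl
  simp only [h1]
  rw [← ENNReal.tsum_mul_left]
  -- Extensions exist only along possible transitions, but `f` vanishes on the other pairs, so the
  -- sum may run over all of them.
  have h2 : Set.indicator {x : Act 𝒜 × Proc 𝒜 | ∃ ρ : PMF (Proc 𝒜), D.PStep x.1 ρ ∧ 0 < ρ x.2} f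
      = f := by
    rw [Set.indicator_eq_self]
    intro x hx
    by_cases ha : S.act D = x.1
    · refine ⟨S.tgt D, ha ▸ S.pStep D hD, pos_iff_ne_zero.2 fun e => hx ?_⟩
      simp [f, e]
    · exact (hx (by simp [f, ha])).elim
  refine (tsum_subtype {x : Act 𝒜 × Proc 𝒜 | ∃ ρ : PMF (Proc 𝒜), D.PStep x.1 ρ ∧ 0 < ρ x.2}
    f).trans ?_
  rw [h2, ENNReal.tsum_prod', tsum_eq_single (S.act D)]
  · simp [f, mul_assoc]
  · intro α hα
    simp [f, Ne.symm hα]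

open Classical in
/-- A function that decreases by `1` in the mean bounds the expected number of steps. -/
theorem tsum_active_le {h : Proc 𝒜 → ℝ≥0∞}
    (hh : ∀ D ∈ S.R, 1 + ∑' D', S.tgt D D' * (if S.Next D D' then h D' else 0) ≤ h D) :
    ∑' ω, S.active B ω ≤ h B := by
  -- The expected number of steps before time `n`, plus the mean of `h` over the fragments still
  -- active at time `n`, never exceeds `h B`.
  have key : ∀ n : ℕ, (∑ i ∈ Finset.range n, ∑' ω : (D : Proc 𝒜) × Frag B D,
      if ω.2.length = i then S.active B ω else 0) +
      ∑' ω : (D : Proc 𝒜) × Frag B D,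
        (if ω.2.length = n then S.active B ω * h ω.1 else 0) ≤ h B := by
    have hL : ∀ n : ℕ, ∑' ω : (D : Proc 𝒜) × Frag B D,
        (if ω.2.length = n then S.active B ω * h ω.1 else 0) =
        (if 0 = n then S.weight 0 [] B * h B else 0) +
        ∑' ω : (D : Proc 𝒜) × Frag B D, S.active B ω *
          ∑' D', S.tgt ω.1 D' * (if ω.2.length + 1 = n then
            (if S.Next ω.1 D' then 1 else 0) * h D' else 0) := by
      intro n
      have := S.tsum_cone_mul (B := B) fun m tr D => if m = n then S.weight m tr D * h D else 0
      simp only [weight_succ] at this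
      rw [← this]
      refine tsum_congr fun ω => ?_
      split_ifs <;> simp [active, mul_assoc]
    intro n
    induction n with
    | zero =>
      rw [hL]
      simp only [Finset.range_zero, Finset.sum_empty, zero_add, if_true, Nat.succ_ne_zero,
        if_false, mul_zero, tsum_zero, add_zero]
      exact mul_le_of_le_one_left' (S.weight_le_one _ _ _)
    | succ n ih =>
      refine le_trans ?_ ih
      rw [Finset.sum_range_succ, add_assoc]
      gcongr
      rw [hL, if_neg (by omega), zero_add, ← ENNReal.tsum_add]
      refine ENNReal.tsum_le_tsum fun ω => ?_
      by_cases hn : ω.2.length = n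
      · by_cases h0 : S.active B ω = 0
        · simp [h0]
        · simp only [hn, if_true]
          have := hh _ (S.mem_of_active_ne_zero h0).1
          calc _ = S.active B ω *
              (1 + ∑' D', S.tgt ω.1 D' * (if S.Next ω.1 D' then h D' else 0)) := by
                rw [mul_add, mul_one]; simp
            _ ≤ _ := by gcongr
      · simp [hn]
  have hsum : ∑' ω, S.active B ω = ∑' n : ℕ, ∑' ω : (D : Proc 𝒜) × Frag B D,
      if ω.2.length = n then S.active B ω else 0 := by
    rw [ENNReal.tsum_comm]
    refine tsum_congr fun ω => ?_
    rw [tsum_eq_single ω.2.length] <;> simp +contextual [eq_comm]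
  rw [hsum]
  exact ENNReal.tsum_le_of_sum_range_le fun n => le_self_add.trans (key n)

open Classical in
/-- The probability that the step from `D` ends the execution with a property `p`. -/
noncomputable def exit (p : Proc 𝒜 → Prop) (D : Proc 𝒜) : ℝ≥0∞ :=
  ∑' D', if p D' ∧ ¬ S.Next D D' then S.tgt D D' else 0

theorem exit_eq_zero {p : Proc 𝒜 → Prop} {D : Proc 𝒜}
    (h : ∀ D', p D' → S.tgt D D' ≠ 0 → S.Next D D') : S.exit p D = 0 := by
  rw [exit, ENNReal.tsum_eq_zero]
  intro D'
  split_ifs with h'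
  · exact by_contra fun h'' => h'.2 (h D' h'.1 h'')
  · rfl

theorem cone_add (ω : (D : Proc 𝒜) × Frag B D) :
    (S.sched B).cone ω.2 = S.active B ω + (S.sched B).stopProb ω.2 := by
  rw [Scheduler.stopProb, sched_none, active, ← mul_add,
    add_tsub_cancel_of_le (S.weight_le_one _ _ _), mul_one]

/-- The recursion applied to the stopping probability: an execution stops at its start or by a step
after which the strategy does not go on. -/
theorem tsum_stopProb (p : Proc 𝒜 → Prop) [DecidablePred p] :
    (∑' ω : (D : Proc 𝒜) × Frag B D, if p ω.1 then (S.sched B).stopProb ω.2 else 0) =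
      (if p B then 1 - S.weight 0 [] B else 0) + ∑' ω, S.active B ω * S.exit p ω.1 := by
  have := S.tsum_cone_mul (B := B) fun m tr D => if p D then 1 - S.weight m tr D else 0
  simp only [weight_succ] at this
  calc _ = _ := tsum_congr fun ω => by
        split_ifs
        · rw [Scheduler.stopProb, sched_none]
        · rw [mul_zero]
    _ = _ := this
    _ = _ := by
      congr 1
      refine tsum_congr fun ω => ?_
      congr 1
      refine tsum_congr fun D' => ?_
      by_cases h1 : p D' <;> by_cases h2 : S.Next ω.1 D' <;> simp [h1, h2]

theorem one_sub_weight (hB : B ∈ S.R) : 1 - S.weight 0 [] B = S.s := by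
  have : S.weight 0 [] B = 1 - S.s := by simp [weight, hB]
  rw [this, ENNReal.sub_sub_cancel ENNReal.one_ne_top S.s_le_one]

/-- With `G = 1` the total cone mass is one plus the active mass; it is also the active plus the
stopped mass, and finiteness allows cancelling. -/
theorem tsum_stopProb_eq_one (h : ∑' ω, S.active B ω ≠ ∞) :
    ∑' ω : (D : Proc 𝒜) × Frag B D, (S.sched B).stopProb ω.2 = 1 := by
  have h1 := S.tsum_cone_mul (B := B) fun _ _ _ => 1
  simp only [mul_one, PMF.tsum_coe] at h1
  simp only [cone_add, ENNReal.tsum_add] at h1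
  rw [add_comm] at h1
  exact (ENNReal.add_left_inj h).1 h1

/-- The distribution of the final process. -/
theorem exists_weakCombined (h : ∑' ω, S.active B ω ≠ ∞) {α : Act 𝒜}
    (hs : (S.s = 0 ∧ B ∈ S.R) ∨ α = .tau)
    (hact : ∀ D ∈ S.R, S.act D = α ∨ ∀ D', S.tgt D D' ≠ 0 → S.Next D D') :
    ∃ ρ : PMF (Proc 𝒜), WeakCombined B α ρ ∧
      ∀ D, ρ D = ∑' ω : Frag B D, (S.sched B).stopProb ω := by
  have h1 := S.tsum_stopProb_eq_one h
  refine ⟨⟨fun D => ∑' ω : Frag B D, (S.sched B).stopProb ω, ?_⟩, ⟨S.sched B, h1, ?_, ?_⟩, ?_⟩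
  · rw [ENNReal.tsum_sigma'] at h1
    exact h1 ▸ ENNReal.summable.hasSum
  · intro D ω hω
    -- Stopping at the start leaves the empty trace, which `hs` allows only for τ. Later stops
    -- follow a step that is not continued, whose action is `α` by `hact`.
    cases ω with
    | nil =>
      rcases hs with hs | rfl
      · simp [Scheduler.stopProb, sched_none, weight, hs, Frag.length, Frag.trace] at hω
      · rfl
    | @snoc D' ω β _ hβ =>
      rw [Scheduler.stopProb, cone_snoc, sched_none] at hω
      have h2 := (CanonicallyOrderedAdd.mul_pos.1 hω).1
      have h3 := (CanonicallyOrderedAdd.mul_pos.1 hω).2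
      have h4 := (CanonicallyOrderedAdd.mul_pos.1 h2).1
      have h5 := (CanonicallyOrderedAdd.mul_pos.1 h2).2
      obtain ⟨hD', htr⟩ := S.mem_of_active_ne_zero h4.ne'
      rw [Frag.trace_snoc, htr, List.nil_append] at h3 ⊢
      split_ifs at h5 with hβ'
      · subst hβ'
        rcases hact D' hD' with e | hn
        · rw [e]
        · rw [show (Frag.snoc ω (S.act D') D hβ).length = ω.length + 1 from rfl, weight_succ,
            if_pos (hn D h5.ne')] at h3
          simp at h3
      · exact (h5.false).elim
  · exact fun D => rfl
  · exact fun D => rfl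

theorem tsum_final {ρ : PMF (Proc 𝒜)}
    (hρ : ∀ D, ρ D = ∑' ω : Frag B D, (S.sched B).stopProb ω) (p : Proc 𝒜 → Prop)
    [DecidablePred p] :
    (∑' D, if p D then ρ D else 0) =
      (if p B then 1 - S.weight 0 [] B else 0) + ∑' ω, S.active B ω * S.exit p ω.1 := by
  rw [← S.tsum_stopProb p, ENNReal.tsum_sigma']
  refine tsum_congr fun D => ?_
  split_ifs
  · exact hρ D
  · simp

end Strategy

open Classical in
/-- Almost sure termination of a finite strategy in which some rank can always decrease. -/
theorem Strategy.tsum_active_ne_top (S : Strategy 𝒜) {B : Proc 𝒜} (hf : S.R.Finite)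
    (hB : B ∈ S.R) (rank : Proc 𝒜 → ℕ)
    (hrank : ∀ D ∈ S.R, ∃ D', S.tgt D D' ≠ 0 ∧ (S.Next D D' → rank D' < rank D)) :
    ∑' ω, S.active B ω ≠ ∞ := by
  have : Nonempty (Proc 𝒜) := ⟨B⟩
  choose! nx hnx hnx' using hrank
  -- As `R` is finite, the step that lowers the rank or exits has probability at least some `ε > 0`
  -- everywhere.
  obtain ⟨D₀, hD₀, hmin⟩ := Set.exists_min_image S.R (fun D => S.tgt D (nx D)) hf ⟨B, hB⟩
  obtain ⟨D₁, hD₁, hmax⟩ := Set.exists_max_image S.R rank hf ⟨B, hB⟩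
  set ε := S.tgt D₀ (nx D₀) with hε
  have hε0 : ε ≠ 0 := hnx D₀ hD₀
  have hε1 : ε ≠ ∞ := PMF.apply_ne_top _ _
  set N := rank D₁
  -- The geometric sums are chosen so that `ε * g (k + 1) = 1 + g k`.
  let g : ℕ → ℝ≥0∞ := fun k => ∑ j ∈ Finset.range k, ε⁻¹ ^ (j + 1)
  have hgtop : ∀ k, g k ≠ ∞ := fun k => ENNReal.sum_ne_top.2 fun j _ =>
    ENNReal.pow_ne_top (ENNReal.inv_ne_top.2 hε0)
  have hgmono : Monotone g := fun a b hab =>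
    Finset.sum_le_sum_of_subset (Finset.range_mono hab)
  have hgs : ∀ k, ε * g (k + 1) = 1 + g k := by
    intro k
    simp only [g, Finset.mul_sum]
    have : ∀ j : ℕ, ε * ε⁻¹ ^ (j + 1) = ε⁻¹ ^ j := fun j => by
      rw [pow_succ', ← mul_assoc, ENNReal.mul_inv_cancel hε0 hε1, one_mul]
    simp only [this]
    rw [Finset.sum_range_succ', pow_zero, add_comm]
  -- A bounded function of the rank to which `tsum_active_le` applies. The summand `1` in `g (N +
  -- 1)` covers an exit from rank `0`, where `h` is replaced by zero.
  let h : Proc 𝒜 → ℝ≥0∞ := fun D => g (N + 1) - g (N - rank D)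
  have hg : ∀ D, h D + g (N - rank D) = g (N + 1) := fun D =>
    tsub_add_cancel_of_le (hgmono (by omega))
  refine ne_top_of_le_ne_top (b := h B) (ne_top_of_le_ne_top (hgtop (N + 1)) tsub_le_self)
    (S.tsum_active_le fun D hD => ?_)
  have hr : rank D ≤ N := hmax D hD
  set k := N - rank D with hk
  set q : Proc 𝒜 → ℝ≥0∞ := fun D' => if S.Next D D' then h D' else 0
  have hq : ∀ D', q D' ≤ g (N + 1) := fun D' => by
    simp only [q]
    split_ifs
    · exact tsub_le_self
    · exact zero_le
  have hqn : q (nx D) + g (k + 1) ≤ g (N + 1) := by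
    simp only [q]
    split_ifs with hn
    · rw [← hg (nx D)]
      gcongr
      exact hgmono (by have := hnx' D hD hn; omega)
    · rw [zero_add]; exact hgmono (by omega)
  have hsum : (∑' D', S.tgt D D' * q D') + (1 + g k) ≤ g (N + 1) := by
    rw [← hgs]
    have e1 : ε * g (k + 1) = ∑' D', if D' = nx D then ε * g (k + 1) else 0 := by
      rw [tsum_ite_eq]
    have e2 : g (N + 1) = ∑' D', S.tgt D D' * g (N + 1) := by
      rw [ENNReal.tsum_mul_right, PMF.tsum_coe, one_mul]
    rw [e1, e2, ← ENNReal.tsum_add]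
    refine ENNReal.tsum_le_tsum fun D' => ?_
    split_ifs with e
    · subst e
      calc _ ≤ S.tgt D (nx D) * q (nx D) + S.tgt D (nx D) * g (k + 1) := by
            gcongr; exact hmin D hD
        _ = S.tgt D (nx D) * (q (nx D) + g (k + 1)) := (mul_add _ _ _).symm
        _ ≤ _ := by gcongr
    · rw [add_zero]; gcongr; exact hq D'
  rw [← hg D, ← hk, ← add_assoc] at hsum
  rw [add_comm]
  exact (ENNReal.add_le_add_iff_right (hgtop k)).1 hsum

/-! Liftings of equivalences. -/

section

variable {X : Type u} {E : Setoid X}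

open Classical in
/-- Distributions that agree on the equivalence classes are related. -/
theorem lift_of_tsum_eq {ρ₁ ρ₂ : PMF X}
    (h : ∀ C : Quotient E, (∑' x, if Quotient.mk E x = C then ρ₁ x else 0) =
      ∑' x, if Quotient.mk E x = C then ρ₂ x else 0) : Lift E.r ρ₁ ρ₂ := by
  let m : Quotient E → ℝ≥0∞ := fun C => ∑' x, if Quotient.mk E x = C then ρ₁ x else 0
  have hm : ∀ C, m C ≠ ∞ := fun C => by
    refine ne_top_of_le_ne_top ENNReal.one_ne_top (b := 1) ?_
    rw [← ρ₁.tsum_coe]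
    refine ENNReal.tsum_le_tsum fun x => ?_
    split_ifs
    · exact le_rfl
    · exact zero_le
  -- Inside each class the coupling is the product measure divided by the common mass of the class.
  let f : X → X → ℝ≥0∞ := fun x y =>
    if Quotient.mk E x = Quotient.mk E y then ρ₁ x * ρ₂ y * (m (Quotient.mk E y))⁻¹ else 0
  have row : ∀ x, ∑' y, f x y = ρ₁ x := by
    intro x
    have : ∀ y, f x y = ρ₁ x * (m (Quotient.mk E x))⁻¹ *
        if Quotient.mk E y = Quotient.mk E x then ρ₂ y else 0 := by
      intro y
      by_cases e : Quotient.mk E x = Quotient.mk E y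
      · simp only [f, e, if_true]; ring
      · simp [f, e, Ne.symm e]
    simp only [this]
    rw [ENNReal.tsum_mul_left, ← h]
    change _ * m _ = _
    by_cases h0 : m (Quotient.mk E x) = 0
    · have := ENNReal.tsum_eq_zero.1 h0 x
      simp only [if_true] at this
      simp [this]
    · rw [mul_assoc, ENNReal.inv_mul_cancel h0 (hm _), mul_one]
  have col : ∀ y, ∑' x, f x y = ρ₂ y := by
    intro y
    have : ∀ x, f x y = ρ₂ y * (m (Quotient.mk E y))⁻¹ *
        if Quotient.mk E x = Quotient.mk E y then ρ₁ x else 0 := by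
      intro x
      by_cases e : Quotient.mk E x = Quotient.mk E y
      · simp only [f, e, if_true]; ring
      · simp [f, e]
    simp only [this]
    rw [ENNReal.tsum_mul_left]
    change _ * m _ = _
    by_cases h0 : m (Quotient.mk E y) = 0
    · have := ENNReal.tsum_eq_zero.1 ((h _).symm.trans h0) y
      simp only [if_true] at this
      simp [this]
    · rw [mul_assoc, ENNReal.inv_mul_cancel h0 (hm _), mul_one]
  refine ⟨f, fun x y => ?_, fun x y hxy => ?_, row, col⟩
  · calc f x y ≤ ∑' y, f x y := ENNReal.le_tsum y
      _ = ρ₁ x := row x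
      _ ≤ 1 := ρ₁.coe_le_one x
  · by_contra hn
    have : Quotient.mk E x ≠ Quotient.mk E y := fun e => hn (Quotient.exact e)
    simp [f, this] at hxy

open Classical in
theorem tsum_of_support {ρ : PMF X} {C : Quotient E} (h : ∀ x, ρ x ≠ 0 → Quotient.mk E x = C)
    (C' : Quotient E) : (∑' x, if Quotient.mk E x = C' then ρ x else 0) =
      if C = C' then 1 else 0 := by
  have : ∀ x, (if Quotient.mk E x = C' then ρ x else 0) = if C = C' then ρ x else 0 := by
    intro x
    by_cases h0 : ρ x = 0
    · simp [h0]
    · rw [h x h0]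
  simp only [this]
  split_ifs
  · exact ρ.tsum_coe
  · exact tsum_zero

theorem lift_of_support {ρ₁ ρ₂ : PMF X} {C : Quotient E}
    (h₁ : ∀ x, ρ₁ x ≠ 0 → Quotient.mk E x = C) (h₂ : ∀ x, ρ₂ x ≠ 0 → Quotient.mk E x = C) :
    Lift E.r ρ₁ ρ₂ :=
  lift_of_tsum_eq fun C' => (tsum_of_support h₁ C').trans (tsum_of_support h₂ C').symm

end

section

variable {n : ℕ} (w : Weights n) (P : Fin n → Proc 𝒜)

theorem Weights.tsum_map (p : Proc 𝒜 → Prop) [DecidablePred p] :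
    (∑' x, if p x then (w.dist.map P) x else 0) =
      ENNReal.ofReal (∑ i, if p (P i) then w.p i else 0) := by
  classical
  have h1 : ∀ x, (if p x then (w.dist.map P) x else 0) =
      ∑ i, if x = P i then (if p (P i) then ENNReal.ofReal (w.p i) else 0) else 0 := by
    intro x
    rw [PMF.map_apply, tsum_fintype]
    by_cases hp : p x
    · rw [if_pos hp]
      refine Finset.sum_congr rfl fun i _ => ?_
      by_cases e : x = P i
      · simp [← e, hp, w.dist_apply]
      · simp [e]
    · rw [if_neg hp, Finset.sum_eq_zero]
      intro i _
      by_cases e : x = P i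
      · simp [← e, hp]
      · simp [e]
  simp only [h1]
  rw [Summable.tsum_finsetSum fun i _ => ENNReal.summable,
    ENNReal.ofReal_sum_of_nonneg]
  · refine Finset.sum_congr rfl fun i _ => ?_
    rw [tsum_ite_eq]
    split_ifs <;> simp
  · intro i _
    split_ifs
    · exact (w.mem i).1.le
    · exact le_rfl

theorem Weights.map_ne_zero_iff (x : Proc 𝒜) : (w.dist.map P) x ≠ 0 ↔ ∃ i, P i = x := by
  rw [← PMF.mem_support_iff, PMF.mem_support_map_iff]
  refine exists_congr fun i => and_iff_right ?_
  rw [PMF.mem_support_iff, w.dist_apply]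
  simpa using (w.mem i).1

end

theorem Strategy.exit_eq (S : Strategy 𝒜) {D : Proc 𝒜} {n : ℕ} {w : Weights n}
    {P : Fin n → Proc 𝒜} (h : S.tgt D = w.dist.map P) {p : Proc 𝒜 → Prop} {q : Fin n → Prop}
    [DecidablePred q] (hq : ∀ i, p (P i) ∧ ¬ S.Next D (P i) ↔ q i) :
    S.exit p D = ENNReal.ofReal (∑ i, if q i then w.p i else 0) := by
  classical
  rw [exit, h, w.tsum_map]
  congr 1
  exact Finset.sum_congr rfl fun i _ => if_congr (hq i) rfl rfl

/-! Strategies from distances. -/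

/-- `Near R L n D`: a process of `L` is reached with positive probability in `n` silent
transitions that stay in `R`. -/
def Near (R : Set (Proc 𝒜)) (L : Proc 𝒜 → Prop) : ℕ → Proc 𝒜 → Prop
  | 0, D => L D
  | n + 1, D => ∃ ρ, D.PStep .tau ρ ∧ (∀ D', ρ D' ≠ 0 → D' ∈ R) ∧ ∃ D', ρ D' ≠ 0 ∧ Near R L n D'

theorem EpsTree.exists_pStep {E : Setoid (Proc 𝒜)} {A : Proc 𝒜} (t : EpsTree E A) {i : ℕ}
    {u : List ℕ} (h : t.IsNode (i :: u)) : ∃ ρ, (t.lab u).PStep .tau ρ ∧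
      (∀ D, ρ D ≠ 0 → ∃ j, t.IsNode (j :: u) ∧ t.lab (j :: u) = D) ∧ ρ (t.lab (i :: u)) ≠ 0 := by
  obtain ⟨hu, hi⟩ := (t.isNode_cons _ _).1 h
  rcases t.children u hu with h0 | ⟨h1, hs, -⟩ | ⟨n, w, hn, hs, -⟩
  · omega
  · obtain rfl : i = 0 := by omega
    refine ⟨_, hs.pStep, fun D hD => ⟨0, h, ?_⟩, by simp⟩
    by_contra hne
    exact hD (by simp [Ne.symm hne])
  · refine ⟨_, hs.pStep, fun D hD => ?_, ?_⟩
    · obtain ⟨j, rfl⟩ := (w.map_ne_zero_iff _ _).1 hD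
      exact ⟨j, (t.isNode_cons _ _).2 ⟨hu, by omega⟩, rfl⟩
    · exact (w.map_ne_zero_iff _ _).2 ⟨⟨i, by omega⟩, rfl⟩

/-- The path from the root to `u` witnesses the distance; induction climbs from the node back to the
root. -/
theorem EpsTree.near {E : Setoid (Proc 𝒜)} {A : Proc 𝒜} (t : EpsTree E A)
    {R : Set (Proc 𝒜)} (hR : ∀ u, t.IsNode u → t.lab u ∈ R) {L : Proc 𝒜 → Prop} {u : List ℕ}
    (hu : t.IsNode u) {k : ℕ} (h : Near R L k (t.lab u)) : Near R L (k + u.length) A := by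
  induction u generalizing k with
  | nil => rwa [t.lab_root] at h
  | cons i u ih =>
    obtain ⟨ρ, h1, h2, h3⟩ := t.exists_pStep hu
    rw [List.length_cons, Nat.add_comm u.length, ← Nat.add_assoc]
    refine ih ((t.isNode_cons _ _).1 hu).1 ⟨ρ, h1, fun D hD => ?_, _, h3, h⟩
    obtain ⟨j, hj, rfl⟩ := h2 D hD
    exact hR _ hj

/-- The rank is the distance to a process with a transition in `Q`. At distance zero that transition
is taken, and by `hQ` it exits with positive probability; elsewhere a silent transition inside `R`
has a branch of smaller rank. Hence termination is almost sure. -/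
theorem exists_strategy {R : Set (Proc 𝒜)} (hf : R.Finite) {B : Proc 𝒜} (hB : B ∈ R)
    {α : Act 𝒜} {Q : Proc 𝒜 → PMF (Proc 𝒜) → Prop}
    (hQ : ∀ D ∈ R, ∀ ρ, Q D ρ → ∃ D', ρ D' ≠ 0 ∧ ¬ (α = .tau ∧ D' ∈ R))
    (hnear : ∀ D ∈ R, ∃ n, Near R (fun D => ∃ ρ, D.PStep α ρ ∧ Q D ρ) n D)
    {s : ℝ≥0∞} (hs : s ≤ 1) :
    ∃ S : Strategy 𝒜, S.R = R ∧ S.s = s ∧ ∑' ω, S.active B ω ≠ ∞ ∧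
      ∀ D ∈ R, (S.act D = α ∧ Q D (S.tgt D)) ∨ ∀ D', S.tgt D D' ≠ 0 → S.Next D D' := by
  let rank : Proc 𝒜 → ℕ := fun D => sInf {n | Near R (fun D => ∃ ρ, D.PStep α ρ ∧ Q D ρ) n D}
  have hstep : ∀ D : Proc 𝒜, ∃ (β : Act 𝒜) (ρ : PMF (Proc 𝒜)), D ∈ R → D.PStep β ρ ∧
      ((β = α ∧ Q D ρ) ∨ (β = .tau ∧ (∀ D', ρ D' ≠ 0 → D' ∈ R) ∧
        ∃ D', ρ D' ≠ 0 ∧ rank D' < rank D)) := by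
    intro D
    by_cases hD : D ∈ R
    · have hmem := Nat.sInf_mem (s := {n | Near R (fun D => ∃ ρ, D.PStep α ρ ∧ Q D ρ) n D})
        (hnear D hD)
      change Near R _ (rank D) D at hmem
      cases hr : rank D with
      | zero =>
        rw [hr] at hmem
        obtain ⟨ρ, h1, h2⟩ := hmem
        exact ⟨α, ρ, fun _ => ⟨h1, .inl ⟨rfl, h2⟩⟩⟩
      | succ k =>
        rw [hr] at hmem
        obtain ⟨ρ, h1, h2, D', h3, h4⟩ := hmem
        exact ⟨.tau, ρ, fun _ => ⟨h1, .inr ⟨rfl, h2, D', h3, Nat.lt_succ_of_le (Nat.sInf_le h4)⟩⟩⟩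
    · exact ⟨.tau, PMF.pure D, fun h => (hD h).elim⟩
  choose act tgt hstep using hstep
  let S : Strategy 𝒜 := ⟨R, act, tgt, fun D hD => (hstep D hD).1, s, hs⟩
  refine ⟨S, rfl, rfl, S.tsum_active_ne_top hf hB rank fun D hD => ?_, fun D hD => ?_⟩
  · rcases (hstep D hD).2 with ⟨h1, h2⟩ | ⟨h1, h2, D', h3, h4⟩
    · obtain ⟨D', h3, h4⟩ := hQ D hD _ h2
      exact ⟨D', h3, fun h => (h4 ⟨h1.symm.trans h.1, h.2⟩).elim⟩
    · exact ⟨D', h3, fun _ => h4⟩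
  · rcases (hstep D hD).2 with h | ⟨h1, h2, -⟩
    · exact .inl h
    · exact .inr fun D' hD' => ⟨h1, h2 D' hD'⟩

/-- The strategy never gives up at the start, and its only exits are the transitions into `T`. For
τ, `hT` ensures that arriving in `T` ends the run. -/
theorem exists_weakCombined_of_near {R : Set (Proc 𝒜)} (hf : R.Finite) {B : Proc 𝒜} (hB : B ∈ R)
    {l : Act 𝒜} {T : Proc 𝒜 → Prop} (hT : l = .tau → ∀ D, T D → D ∉ R)
    (hnear : ∀ D ∈ R, ∃ n, Near R (fun D => ∃ D', D.Step (.act l) D' ∧ T D') n D) :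
    ∃ ρ, WeakCombined B l ρ ∧ ∀ D, ρ D ≠ 0 → T D := by
  classical
  have himp : (fun D : Proc 𝒜 => ∃ D', D.Step (.act l) D' ∧ T D') ≤
      fun D => ∃ ρ, D.PStep l ρ ∧ ∃ D', T D' ∧ ρ = PMF.pure D' :=
    fun D ⟨D', h1, h2⟩ => ⟨_, h1.pStep, D', h2, rfl⟩
  have hmono : ∀ n D, Near R (fun D => ∃ D', D.Step (.act l) D' ∧ T D') n D →
      Near R (fun D => ∃ ρ, D.PStep l ρ ∧ ∃ D', T D' ∧ ρ = PMF.pure D') n D := by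
    intro n
    induction n with
    | zero => exact himp
    | succ n ih => exact fun D ⟨ρ, h1, h2, D', h3, h4⟩ => ⟨ρ, h1, h2, D', h3, ih D' h4⟩
  obtain ⟨S, rfl, hs, hfin, hS⟩ := exists_strategy hf hB
    (Q := fun _ ρ => ∃ D', T D' ∧ ρ = PMF.pure D') (by
      rintro D hD ρ ⟨D', h1, rfl⟩
      exact ⟨D', by simp, fun h => hT h.1 D' h1 h.2⟩)
    (fun D hD => (hnear D hD).imp fun n => hmono n D) zero_le_one
  obtain ⟨ρ, h1, h2⟩ := S.exists_weakCombined hfin (α := l) (.inl ⟨hs, hB⟩)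
    fun D hD => (hS D hD).imp_left And.left
  refine ⟨ρ, h1, fun D hD => by_contra fun hn => hD ?_⟩
  have h3 := S.tsum_final h2 fun D => ¬ T D
  have h4 : ∑' ω, S.active B ω * S.exit (fun D => ¬ T D) ω.1 = 0 := by
    rw [ENNReal.tsum_eq_zero]
    intro ω
    by_cases h0 : S.active B ω = 0
    · rw [h0, zero_mul]
    rw [S.exit_eq_zero, mul_zero]
    intro D' hT' hD'
    rcases hS _ (S.mem_of_active_ne_zero h0).1 with ⟨-, L, hL, e⟩ | h
    · rw [e] at hD'
      exact (hD' (PMF.pure_apply_of_ne _ _ fun h => hT' (h ▸ hL))).elim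
    · exact h D' hD'
  rw [S.one_sub_weight hB, hs, h4, ite_self, zero_add] at h3
  simpa [hn] using ENNReal.tsum_eq_zero.1 h3 D

/-- The strategy with empty `R` stops at once. -/
theorem exists_weakCombined_refl (B : Proc 𝒜) :
    ∃ ρ, WeakCombined B .tau ρ ∧ ∀ D, ρ D ≠ 0 → D = B := by
  classical
  let S : Strategy 𝒜 := ⟨∅, fun _ => .tau, PMF.pure, fun D hD => hD.elim, 0, zero_le_one⟩
  have h0 : ∀ ω, S.active B ω = 0 := fun ω => by simp [Strategy.active, Strategy.weight, S]
  obtain ⟨ρ, h1, h2⟩ := S.exists_weakCombined (B := B) (α := .tau) (by simp [h0]) (.inr rfl)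
    fun D hD => hD.elim
  refine ⟨ρ, h1, fun D hD => by_contra fun hn => hD ?_⟩
  have h3 := S.tsum_final h2 fun D => ¬ D = B
  simp only [h0, not_true, if_false, zero_mul, tsum_zero, add_zero] at h3
  simpa [hn] using ENNReal.tsum_eq_zero.1 h3 D

/-! Branching bisimulations are weak bisimulations. -/

section

variable {E : Setoid (Proc 𝒜)} {A B : Proc 𝒜}

/-- The part of the class of `A` that is reachable from `B`. -/
def reachClass (E : Setoid (Proc 𝒜)) (A B : Proc 𝒜) : Set (Proc 𝒜) :=
  {D | Reachable B D ∧ E.r D A}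

theorem finite_reachClass : (reachClass E A B).Finite :=
  (finite_reachable B).subset fun _ h => h.1

theorem EpsTree.near_reachClass {A B D : Proc 𝒜} (hD : D ∈ reachClass E A B) (t : EpsTree E D)
    {L : Proc 𝒜 → Prop} {u : List ℕ} (hu : t.IsNode u) (h : L (t.lab u)) :
    ∃ n, Near (reachClass E A B) L n D :=
  ⟨_, t.near (R := reachClass E A B) (fun _ hv => ⟨hD.1.trans (t.silentReachable hv).reachable,
    E.trans' (t.lab_mem _ hv) hD.2⟩) hu (k := 0) h⟩

theorem EllTrans.exists_weakCombined {l : Act 𝒜} {C : Quotient E} (hAB : E.r A B)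
    (hl : l = .tau → C ≠ Quotient.mk E A)
    (h : ∀ D, E.r A D → EllTrans E D l C) :
    ∃ ρ, WeakCombined B l ρ ∧ ∀ D, ρ D ≠ 0 → Quotient.mk E D = C := by
  refine exists_weakCombined_of_near (finite_reachClass (E := E) (A := A) (B := B))
    ⟨.refl, E.symm' hAB⟩ (fun e D hD hD' => hl e (hD ▸ Quotient.sound hD'.2)) fun D hD => ?_
  obtain ⟨t, ht, hleaf⟩ := h D (E.symm' hD.2)
  obtain ⟨u, hu⟩ := ht.exists_leaf
  exact t.near_reachClass hD hu.1 (hleaf u hu)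

theorem one_sub_arrive {n : ℕ} (w : Weights n) (P : Fin n → Proc 𝒜) (C : Quotient E)
    [∀ i, Decidable (Quotient.mk E (P i) = C)] :
    1 - arrive E w P C = ∑ i, if Quotient.mk E (P i) = C then 0 else w.p i := by
  classical
  rw [arrive, ← w.sum_eq_one, ← Finset.sum_sub_distrib]
  refine Finset.sum_congr rfl fun i _ => ?_
  split_ifs <;> simp

open Classical in
-- Stopping at `B` with probability `a` accounts for the branches of `A` that stay in the class. The
-- rest of the mass leaves the class by collective steps which all share the conditional
-- distribution of `A`, so it does not matter where the exit happens.
theorem IsBranchingBisim.exists_weakCombined_coll (hE : IsBranchingBisim E) (hAB : E.r A B)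
    {n : ℕ} {w : Weights (n + 2)} {P : Fin (n + 2) → Proc 𝒜} (hs : A.CollStep n w P)
    {i : Fin (n + 2)} (hi : ¬ E.r (P i) A) :
    ∃ ρ, WeakCombined B .tau ρ ∧ ∀ C : Quotient E,
      (∑' D, if Quotient.mk E D = C then ρ D else 0) = ENNReal.ofReal (arrive E w P C) := by
  have hne : Quotient.mk E (P i) ≠ Quotient.mk E A := fun e => hi (Quotient.exact e)
  set a := arrive E w P (Quotient.mk E A) with ha
  have ha0 : 0 ≤ a := arrive_nonneg _ _ _
  have ha1 : a < 1 := (arrive_lt_one_iff w P).2 ⟨i, hne⟩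
  set R := reachClass E A B
  have hB : B ∈ R := ⟨.refl, E.symm' hAB⟩
  let Q : Proc 𝒜 → PMF (Proc 𝒜) → Prop := fun D ρ =>
    ∃ (m : ℕ) (v : Weights (m + 2)) (P' : Fin (m + 2) → Proc 𝒜), D.CollStep m v P' ∧
      ρ = v.dist.map P' ∧ ∃ j, ¬ E.r (P' j) D
  obtain ⟨S, hSR, hSs, hfin, hS⟩ := exists_strategy (finite_reachClass (E := E) (A := A) (B := B))
    hB (α := .tau) (Q := Q) (s := ENNReal.ofReal a) (by
      rintro D hD _ ⟨m, v, P', h1, rfl, j, hj⟩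
      exact ⟨P' j, (v.map_ne_zero_iff _ _).2 ⟨j, rfl⟩, fun h => hj (E.trans' h.2.2 (E.symm' hD.2))⟩)
    (by
      intro D hD
      obtain ⟨t, ht, hleaf⟩ := (hE A D (E.symm' hD.2) (Quotient.mk E (P i))).2 _ hne
        (.of_collTo (collTo_of_collStep hs hi _))
      obtain ⟨u, hu⟩ := ht.exists_leaf
      obtain ⟨m, v, P', h1, h2, -⟩ := hleaf u hu
      obtain ⟨j, hj⟩ := (arrive_lt_one_iff v P').1 h2
      exact t.near_reachClass hD hu.1
        ⟨_, h1.pStep, m, v, P', h1, rfl, j, fun h => hj (Quotient.sound h)⟩)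
    (by simpa using ha1.le)
  have hB' : B ∈ S.R := hSR ▸ hB
  obtain ⟨ρ, h1, h2⟩ := S.exists_weakCombined hfin (α := .tau) (.inr rfl)
    fun D hD => (hS D (hSR ▸ hD)).imp_left And.left
  refine ⟨ρ, h1, fun C => ?_⟩
  have hnext : ∀ D ∈ S.R, ∀ m (v : Weights (m + 2)) P', S.act D = .tau → D.CollStep m v P' →
      ∀ j, S.Next D (P' j) ↔ Quotient.mk E (P' j) = Quotient.mk E A := by
    intro D hD m v P' hact h j
    rw [hSR] at hD
    rw [Strategy.Next, hSR]
    exact ⟨fun h => Quotient.sound h.2.2, fun h' => ⟨hact, hD.1.tail ⟨_, h.step j⟩,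
      Quotient.exact h'⟩⟩
  -- The equality of conditional probabilities, with denominators cleared; both sides vanish at
  -- processes whose chosen step cannot exit.
  have hexit : ∀ D ∈ S.R, ENNReal.ofReal (1 - a) * S.exit (fun D => Quotient.mk E D = C) D =
      (if C = Quotient.mk E A then 0 else ENNReal.ofReal (arrive E w P C)) *
        S.exit (fun _ => True) D := by
    intro D hD
    rcases hS D (hSR ▸ hD) with ⟨hact, m, v, P', hs', htgt, j, hj⟩ | h
    · have hN := hnext D hD m v P' hact hs'
      have hDA : Quotient.mk E D = Quotient.mk E A := by
        rw [hSR] at hD; exact Quotient.sound hD.2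
      by_cases hC : C = Quotient.mk E A
      · rw [if_pos hC, zero_mul, S.exit_eq_zero, mul_zero]
        intro D' h3 h4
        rw [htgt, v.map_ne_zero_iff] at h4
        obtain ⟨k, rfl⟩ := h4
        exact (hN k).2 (h3.trans hC)
      · rw [if_neg hC, S.exit_eq htgt (q := fun k => Quotient.mk E (P' k) = C),
          S.exit_eq htgt (q := fun k => ¬ Quotient.mk E (P' k) = Quotient.mk E A)]
        rotate_left
        · exact fun k => by rw [true_and, hN]
        · exact fun k => ⟨And.left, fun h => ⟨h, fun h' => hC (h.symm.trans ((hN k).1 h'))⟩⟩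
        have e1 : (∑ k, if Quotient.mk E (P' k) = C then v.p k else 0) = arrive E v P' C := rfl
        have e2 : (∑ k, if ¬ Quotient.mk E (P' k) = Quotient.mk E A then v.p k else 0) =
            1 - arrive E v P' (Quotient.mk E D) := by
          rw [one_sub_arrive, hDA]
          refine Finset.sum_congr rfl fun k _ => ?_
          split_ifs <;> rfl
        rw [e1, e2, ← ENNReal.ofReal_mul (by linarith), ← ENNReal.ofReal_mul (arrive_nonneg _ _ _)]
        have hlt : arrive E v P' (Quotient.mk E D) < 1 :=
          (arrive_lt_one_iff v P').2 ⟨j, fun e => hj (Quotient.exact e)⟩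
        have := hE.arrive_eq (Quotient.exact hDA.symm) hs hi hs' hj hC
        rw [div_eq_div_iff (by linarith) (by linarith)] at this
        rw [this, ha]
        ring_nf
    · rw [S.exit_eq_zero fun D' _ => h D', S.exit_eq_zero fun D' _ => h D', mul_zero, mul_zero]
  -- Almost sure termination: what does not stop at the start must exit.
  have htotal : ∑' ω, S.active B ω * S.exit (fun _ => True) ω.1 = ENNReal.ofReal (1 - a) := by
    have h3 := S.tsum_stopProb (B := B) fun _ => True
    rw [S.one_sub_weight hB', hSs] at h3
    simp only [if_true] at h3
    rw [S.tsum_stopProb_eq_one hfin] at h3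
    rw [ENNReal.ofReal_sub _ ha0, ENNReal.ofReal_one]
    exact ENNReal.eq_sub_of_add_eq ENNReal.ofReal_ne_top (by rw [add_comm]; exact h3.symm)
  have hpos : ENNReal.ofReal (1 - a) ≠ 0 := by simpa using ha1
  have hC : ∑' ω, S.active B ω * S.exit (fun D => Quotient.mk E D = C) ω.1 =
      if C = Quotient.mk E A then 0 else ENNReal.ofReal (arrive E w P C) := by
    refine (ENNReal.mul_right_inj hpos ENNReal.ofReal_ne_top).1 ?_
    rw [← ENNReal.tsum_mul_left, mul_comm (ENNReal.ofReal _) (ite _ _ _), ← htotal,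
      ← ENNReal.tsum_mul_left]
    rw [htotal]
    refine tsum_congr fun ω => ?_
    by_cases h0 : S.active B ω = 0
    · simp [h0]
    · rw [mul_left_comm, hexit _ (S.mem_of_active_ne_zero h0).1, mul_left_comm]
  rw [S.tsum_final h2 fun D => Quotient.mk E D = C, hC,
    S.one_sub_weight hB', hSs]
  have hBA : Quotient.mk E B = Quotient.mk E A := Quotient.sound (E.symm' hAB)
  by_cases e : C = Quotient.mk E A
  · rw [if_pos e, if_pos (hBA.trans e.symm), add_zero, e]
  · rw [if_neg e, if_neg fun h => e (h.symm.trans hBA), zero_add]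

open Classical in
-- A silent transition that surely stays in the class is matched by doing nothing; any other is
-- matched by running to an exit from the class or to the external action.
theorem IsBranchingBisim.isWeakBisim (hE : IsBranchingBisim E) : IsWeakBisim E := by
  intro A B hAB α ρA hA
  have stay : ∀ ρ : PMF (Proc 𝒜), (∀ D, ρ D ≠ 0 → Quotient.mk E D = Quotient.mk E A) →
      ∃ ρB, WeakCombined B .tau ρB ∧ Lift E.r ρ ρB := by
    intro ρ hρ
    obtain ⟨ρB, h1, h2⟩ := exists_weakCombined_refl B
    refine ⟨ρB, h1, lift_of_support hρ fun D hD => ?_⟩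
    rw [h2 D hD]
    exact Quotient.sound (E.symm' hAB)
  rcases hA.cases' with ⟨A', hs, rfl⟩ | ⟨rfl, n, w, P, hs, rfl⟩
  · have hpure : ∀ D, PMF.pure A' D ≠ 0 → Quotient.mk E D = Quotient.mk E A' := by
      intro D hD
      by_contra hn
      exact hD (by rw [PMF.pure_apply, if_neg]; rintro rfl; exact hn rfl)
    by_cases hstay : α = .tau ∧ Quotient.mk E A' = Quotient.mk E A
    · obtain ⟨rfl, e⟩ := hstay
      exact stay _ fun D hD => (hpure D hD).trans e
    · have hl : (∃ a, α = .ext a) ∨ (α = .tau ∧ Quotient.mk E A' ≠ Quotient.mk E A) := by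
        cases α with
        | ext a => exact .inl ⟨a, rfl⟩
        | tau => exact .inr ⟨rfl, fun e => hstay ⟨rfl, e⟩⟩
      obtain ⟨ρB, h1, h2⟩ := EllTrans.exists_weakCombined (C := Quotient.mk E A') hAB
        (fun e e' => hstay ⟨e, e'⟩) fun D hD => (hE A D hD _).1 α hl (.of_step hs rfl)
      exact ⟨ρB, h1, lift_of_support hpure h2⟩
  · by_cases h : ∃ i, ¬ E.r (P i) A
    · obtain ⟨i, hi⟩ := h
      obtain ⟨ρB, h1, h2⟩ := hE.exists_weakCombined_coll hAB hs hi
      refine ⟨ρB, h1, lift_of_tsum_eq fun C => ?_⟩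
      rw [h2, w.tsum_map]
      rfl
    · push Not at h
      refine stay _ fun D hD => ?_
      obtain ⟨i, rfl⟩ := (w.map_ne_zero_iff _ _).1 hD
      exact Quotient.sound (h i)

end

/-! Equivalences with at most one non-trivial class. -/

/-- The equivalence that only identifies `A` and `B`. -/
def pairSetoid {X : Type*} (A B : X) : Setoid X where
  r x y := x = y ∨ ((x = A ∨ x = B) ∧ (y = A ∨ y = B))
  iseqv :=
    { refl := fun _ => .inl rfl
      symm := by
        rintro x y (rfl | ⟨h, h'⟩)
        · exact .inl rfl
        · exact .inr ⟨h', h⟩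
      trans := by
        rintro x y z (rfl | ⟨h, h'⟩) (rfl | ⟨h1, h2⟩)
        · exact .inl rfl
        · exact .inr ⟨h1, h2⟩
        · exact .inr ⟨h, h'⟩
        · exact .inr ⟨h, h2⟩ }

theorem pairSetoid_cases {X : Type*} {A B : X} {p : X → X → Prop} (hrefl : ∀ x, p x x)
    (h₁ : p A B) (h₂ : p B A) {x y : X} (h : (pairSetoid A B).r x y) : p x y := by
  rcases h with rfl | ⟨rfl | rfl, rfl | rfl⟩
  · exact hrefl _
  · exact hrefl _
  · exact h₁
  · exact h₂
  · exact hrefl _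

theorem pairSetoid_rel {X : Type*} (A B : X) : (pairSetoid A B).r A B :=
  .inr ⟨.inl rfl, .inr rfl⟩

theorem isBranchingBisim_bot : IsBranchingBisim (⊥ : Setoid (Proc 𝒜)) := by
  refine isBranchingBisim_of_local ?_ ?_
  · rintro A _ rfl l A' _ h
    exact .of_step h rfl
  · rintro A _ rfl q C _ h
    exact .of_collTo h

theorem isBranchingBisim_pair {A B : Proc 𝒜}
    (h₁ : ∀ l A', A.Step (.act l) A' → B.Step (.act l) A' ∨ (l = .tau ∧ (A' = A ∨ A' = B)))
    (h₂ : ∀ l B', B.Step (.act l) B' → A.Step (.act l) B' ∨ (l = .tau ∧ (B' = A ∨ B' = B)))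
    (h₃ : ∀ n w P, ¬ A.CollStep n w P) (h₄ : ∀ n w P, ¬ B.CollStep n w P) :
    IsBranchingBisim (pairSetoid A B) := by
  refine isBranchingBisim_of_local (fun _ _ hxy => ?_) (fun _ _ hxy => ?_)
  · refine pairSetoid_cases (p := fun x y => ∀ l x', ((∃ a, l = .ext a) ∨
      (l = .tau ∧ ¬ (pairSetoid A B).r x' x)) → x.Step (.act l) x' →
      EllTrans (pairSetoid A B) y l (Quotient.mk _ x')) ?_ ?_ ?_ hxy
    · exact fun x l x' _ h => .of_step h rfl
    · rintro l A' hl h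
      rcases h₁ l A' h with h' | ⟨rfl, h'⟩
      · exact .of_step h' rfl
      · rcases hl with ⟨a, ha⟩ | ⟨-, hn⟩
        · cases ha
        · exact (hn (.inr ⟨h', .inl rfl⟩)).elim
    · rintro l A' hl h
      rcases h₂ l A' h with h' | ⟨rfl, h'⟩
      · exact .of_step h' rfl
      · rcases hl with ⟨a, ha⟩ | ⟨-, hn⟩
        · cases ha
        · exact (hn (.inr ⟨h', .inr rfl⟩)).elim
  · refine pairSetoid_cases (p := fun x y => ∀ q C, C ≠ Quotient.mk (pairSetoid A B) x →
      CollTo (pairSetoid A B) q C x → QTrans (pairSetoid A B) y q C) ?_ ?_ ?_ hxy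
    · exact fun x q C _ h => .of_collTo h
    · exact fun q C _ ⟨n, w, P, h, _⟩ => (h₃ n w P h).elim
    · exact fun q C _ ⟨n, w, P, h, _⟩ => (h₄ n w P h).elim

theorem Lift.mono {X Y : Type u} {R R' : X → Y → Prop} (h : ∀ x y, R x y → R' x y)
    {ρ₁ : PMF X} {ρ₂ : PMF Y} : Lift R ρ₁ ρ₂ → Lift R' ρ₁ ρ₂ :=
  fun ⟨w, h1, h2, h3⟩ => ⟨w, h1, fun x y hxy => h _ _ (h2 x y hxy), h3⟩

/-- Equality is a branching bisimulation, hence a weak one, so a scheduler for a single transition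
comes without a separate construction. -/
theorem exists_weakCombined_of_pStep {A : Proc 𝒜} {α : Act 𝒜} {ρ : PMF (Proc 𝒜)}
    (h : A.PStep α ρ) (E : Setoid (Proc 𝒜)) : ∃ ρ', WeakCombined A α ρ' ∧ Lift E.r ρ ρ' := by
  obtain ⟨ρ', h1, h2⟩ := isBranchingBisim_bot.isWeakBisim A A rfl α ρ h
  refine ⟨ρ', h1, h2.mono ?_⟩
  rintro x _ rfl
  exact E.refl' x

theorem isWeakBisim_pair {A B : Proc 𝒜}
    (h₁ : ∀ α ρ, A.PStep α ρ → B.PStep α ρ ∨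
      ∃ ρ', WeakCombined B α ρ' ∧ Lift (pairSetoid A B).r ρ ρ')
    (h₂ : ∀ α ρ, B.PStep α ρ → A.PStep α ρ) : IsWeakBisim (pairSetoid A B) := by
  intro x y hxy
  refine pairSetoid_cases (p := fun x y => ∀ α ρ, x.PStep α ρ → ∃ ρ', WeakCombined y α ρ' ∧
    Lift (pairSetoid A B).r ρ ρ') ?_ ?_ ?_ hxy
  · exact fun x α ρ h => exists_weakCombined_of_pStep h _
  · intro α ρ h
    rcases h₁ α ρ h with h | h
    · exact exists_weakCombined_of_pStep h _
    · exact h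
  · exact fun α ρ h => exists_weakCombined_of_pStep (h₂ α ρ h) _

theorem tauECInvariant_pair {A B : Proc 𝒜}
    (h₁ : ∀ g, ReachesEC A g → ∃ g', ReachesEC B g' ∧ RelatedEC (pairSetoid A B).r g g')
    (h₂ : ∀ g, ReachesEC B g → ∃ g', ReachesEC A g' ∧ RelatedEC (pairSetoid A B).r g g') :
    TauECInvariant (pairSetoid A B).r :=
  tauECInvariant_of_forall fun _ _ hxy => pairSetoid_cases
    (p := fun A' B' => ∀ g, ReachesEC A' g → ∃ g', ReachesEC B' g' ∧ RelatedEC (pairSetoid A B).r g g')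
    (fun _ g h => ⟨g, h, fun C hC => ⟨C, hC, .inl rfl⟩⟩) h₁ h₂ hxy

theorem IsTauEC.exists_step {A C : Proc 𝒜} {g : Graph 𝒜} (h : IsTauEC A g) (hC : C ∈ g.V) :
    ∃ l D, Label.Silent l ∧ C.Step l D ∧ D ∈ g.V := by
  obtain ⟨l, D, hD⟩ := h.exists_edge hC
  exact ⟨l, D, h.silent _ _ _ hD, (h.edge _ _ _ hD).2.2, (h.edge _ _ _ hD).2.1⟩

theorem Reachable.mem {A B : Proc 𝒜} (h : Reachable A B) {S : Set (Proc 𝒜)} (hA : A ∈ S)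
    (hS : ∀ C ∈ S, ∀ l D, C.Step l D → D ∈ S) : B ∈ S := by
  induction h with
  | refl => exact hA
  | tail _ h ih => obtain ⟨l, h⟩ := h; exact hS _ ih l _ h

theorem SilentReachable.eq {A B : Proc 𝒜} (h : SilentReachable A B)
    (hA : ∀ l D, Label.Silent l → ¬ A.Step l D) : B = A := by
  rcases Relation.ReflTransGen.cases_head h with rfl | ⟨C, ⟨l, hl, h⟩, _⟩
  · rfl
  · exact (hA l C hl h).elim

/-! The processes that separate the bisimilarities. -/

namespace Term

theorem step_sum_iff {n : ℕ} {α : Fin (n + 1) → Act 𝒜} {T : Fin (n + 1) → Term 𝒜} {l : Label 𝒜}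
    {T' : Term 𝒜} : Step (.sum n α T) l T' ↔ ∃ i, l = .act (α i) ∧ T' = T i := by
  constructor
  · rintro ⟨⟩
    exact ⟨_, rfl, rfl⟩
  · rintro ⟨i, rfl, rfl⟩
    exact .sum _ _ _ _

theorem step_mu_iff {X : ℕ} {T : Term 𝒜} {l : Label 𝒜} {T' : Term 𝒜} :
    Step (.mu X T) l T' ↔ Step (subst X (.mu X T) T) l T' := by
  constructor
  · rintro ⟨⟩
    assumption
  · exact .mu _ _ _ _

end Term

namespace Proc

/-- The inactive process. -/
def zero : Proc 𝒜 := ⟨.nil, by simp [Term.IsProc, Term.WellGuarded, Term.Free]⟩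

/-- `Ω = μX.τ.X`. -/
def omega : Proc 𝒜 := ⟨.mu 0 (.sum 0 ![.tau] ![.var 0]), by
  simp [Term.IsProc, Term.WellGuarded, Term.Free, Term.Unguarded]⟩

noncomputable def half : Weights 2 := ⟨![1 / 2, 1 / 2], by
  intro i; fin_cases i <;> norm_num, by norm_num⟩

/-- `μZ.(a + τ.(½τ.Z ⊕ ½τ.0) + τ.Z)`. -/
noncomputable def looping (a : 𝒜) : Proc 𝒜 :=
  ⟨.mu 0 (.sum 2 ![.ext a, .tau, .tau] ![.nil, .prob 0 half ![.var 0, .nil], .var 0]), by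
    simp [Term.IsProc, Term.WellGuarded, Term.Free, Term.Unguarded, Fin.forall_fin_succ,
      Fin.exists_fin_succ]⟩

/-- `½τ.looping ⊕ ½τ.0`. -/
noncomputable def gamble (a : 𝒜) : Proc 𝒜 :=
  ⟨.prob 0 half ![(looping a).1, .nil], by
    have := (looping a).2
    simp [Term.IsProc] at this
    simp [Term.IsProc, Term.WellGuarded, Term.Free, Fin.forall_fin_succ, Fin.exists_fin_succ, this]⟩

/-- `a + τ.gamble`. -/
noncomputable def unrolled (a : 𝒜) : Proc 𝒜 :=
  ⟨.sum 1 ![.ext a, .tau] ![.nil, (gamble a).1], by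
    have := (gamble a).2
    simp [Term.IsProc] at this
    simp [Term.IsProc, Term.WellGuarded, Term.Free, Fin.forall_fin_succ, Fin.exists_fin_succ, this]⟩

/-- `a.0`. -/
def single (a : 𝒜) : Proc 𝒜 := ⟨.sum 0 ![.ext a] ![.nil], by
  simp [Term.IsProc, Term.WellGuarded, Term.Free]⟩

/-- `τ.a + τ.0`. -/
def choice (a : 𝒜) : Proc 𝒜 := ⟨.sum 1 ![.tau, .tau] ![(single a).1, .nil], by
  simp [Term.IsProc, Term.WellGuarded, Term.Free, Fin.forall_fin_succ, Fin.exists_fin_succ, single]⟩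

/-- `τ.a + τ.0 + a`. -/
def choice' (a : 𝒜) : Proc 𝒜 := ⟨.sum 2 ![.tau, .tau, .ext a] ![(single a).1, .nil, .nil], by
  simp [Term.IsProc, Term.WellGuarded, Term.Free, Fin.forall_fin_succ, Fin.exists_fin_succ, single]⟩

variable {a : 𝒜} {l : Label 𝒜} {D : Proc 𝒜}

theorem eq_iff {A B : Proc 𝒜} : A = B ↔ A.1 = B.1 := Subtype.ext_iff

theorem val_zero : (zero : Proc 𝒜).1 = .nil := rfl

theorem val_omega : (omega : Proc 𝒜).1 = .mu 0 (.sum 0 ![.tau] ![.var 0]) := rfl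

theorem val_single : (single a).1 = .sum 0 ![.ext a] ![.nil] := rfl

theorem val_choice : (choice a).1 = .sum 1 ![.tau, .tau] ![(single a).1, .nil] := rfl

theorem val_choice' :
    (choice' a).1 = .sum 2 ![.tau, .tau, .ext a] ![(single a).1, .nil, .nil] := rfl

theorem val_gamble : (gamble a).1 = .prob 0 half ![(looping a).1, .nil] := rfl

theorem val_unrolled : (unrolled a).1 = .sum 1 ![.ext a, .tau] ![.nil, (gamble a).1] := rfl

theorem not_step_zero : ¬ zero.Step l D := by
  rintro ⟨⟩

theorem step_omega : omega.Step l D ↔ l = .act .tau ∧ D = omega := by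
  simp [Step, val_omega, Term.step_mu_iff, Term.subst, Term.step_sum_iff, eq_iff]

theorem step_single : (single a).Step l D ↔ l = .act (.ext a) ∧ D = zero := by
  simp [Step, val_single, val_zero, Term.step_sum_iff, eq_iff]

theorem step_choice : (choice a).Step l D ↔ l = .act .tau ∧ (D = single a ∨ D = zero) := by
  simp [Step, val_choice, val_zero, Term.step_sum_iff, eq_iff, Fin.exists_fin_succ, and_or_left]

theorem step_choice' : (choice' a).Step l D ↔
    (l = .act .tau ∧ (D = single a ∨ D = zero)) ∨ (l = .act (.ext a) ∧ D = zero) := by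
  simp [Step, val_choice', val_zero, Term.step_sum_iff, eq_iff, Fin.exists_fin_succ, and_or_left,
    or_assoc]

theorem step_unrolled : (unrolled a).Step l D ↔
    (l = .act (.ext a) ∧ D = zero) ∨ (l = .act .tau ∧ D = gamble a) := by
  simp [Step, val_unrolled, val_zero, Term.step_sum_iff, eq_iff, Fin.exists_fin_succ]

theorem step_looping : (looping a).Step l D ↔ (l = .act (.ext a) ∧ D = zero) ∨
    (l = .act .tau ∧ (D = gamble a ∨ D = looping a)) := by
  have h : (fun i => Term.subst 0 (looping a).1 (![.var 0, .nil] i)) = ![(looping a).1, .nil] := by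
    ext1 i
    fin_cases i <;> simp [Term.subst]
  rw [Step]
  conv_lhs => rw [looping]
  rw [Term.step_mu_iff]
  change Term.Step (Term.subst 0 (looping a).1 _) _ _ ↔ _
  simp [val_zero, val_gamble, Term.subst, Term.step_sum_iff, eq_iff, Fin.exists_fin_succ,
    and_or_left, h]

theorem collStep_gamble : (gamble a).CollStep 0 half ![looping a, zero] := by
  have h : (fun i => (![looping a, zero] i : Proc 𝒜).1) = ![(looping a).1, .nil] := by
    ext1 i
    fin_cases i <;> rfl
  rw [CollStep, h]
  exact .prob _ _ _

theorem step_gamble (h : (gamble a).Step l D) : D = looping a ∨ D = zero := by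
  have h' : Term.Step (.prob 0 half ![(looping a).1, .nil]) l D.1 := h
  generalize hT : D.1 = T at h'
  cases h' with
  | prob n w T i =>
    fin_cases i
    · exact .inl (Subtype.ext hT)
    · exact .inr (Subtype.ext hT)

end Proc

/-! ### Relations between the separating processes -/

open Proc

/-- The collective transition must be taken whole and one branch is the deadlock. So no end
component contains `gamble a`, and no leafless tree passes through it without reaching 0. -/
theorem zero_mem_of_silentInto_gamble {a : 𝒜} {S : Set (Proc 𝒜)} (h : SilentInto S (gamble a)) :
    zero ∈ S := by
  rcases h with ⟨D, _, h⟩ | ⟨n, w, P, h, hP⟩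
  · exact (collStep_gamble.not_act h).elim
  · obtain ⟨rfl, -, h'⟩ := collStep_gamble.unique h
    obtain rfl := eq_of_heq h'
    exact hP 1

theorem not_reachesEC_zero (g : Graph 𝒜) : ¬ ReachesEC zero g := by
  rintro ⟨hg, A, hA, hA'⟩
  obtain rfl := hA.eq fun l D _ => not_step_zero
  obtain ⟨l, D, _, h, _⟩ := hg.exists_step hA'
  exact not_step_zero h

theorem exists_reachesEC_of_loop {A B : Proc 𝒜} (h : B.Step (.act .tau) B)
    (hA : SilentReachable A B) : ∃ g, ReachesEC A g ∧ g.V ⊆ {B} := by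
  refine exists_reachesEC (S := {B}) rfl ?_ ?_
  · rintro C rfl
    exact hA
  · rintro C rfl
    exact .inl ⟨_, rfl, h⟩

theorem not_tauECInvariant_omega {R : Proc 𝒜 → Proc 𝒜 → Prop} (h : TauECInvariant R) :
    ¬ R omega zero := by
  intro h'
  obtain ⟨g, hg, -⟩ := exists_reachesEC_of_loop (step_omega.2 ⟨rfl, rfl⟩)
    (.refl : SilentReachable (omega : Proc 𝒜) omega)
  obtain ⟨g', hg', -⟩ := (h _ _ h').1 g hg
  exact not_reachesEC_zero g' hg'

theorem isBranchingBisim_omega : IsBranchingBisim (pairSetoid omega (zero : Proc 𝒜)) := by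
  refine isBranchingBisim_pair (fun l A' h => .inr ?_) (fun l A' h => (not_step_zero h).elim)
    (fun n w P h => h.not_act (step_omega.2 ⟨rfl, rfl⟩)) fun n w P h => not_step_zero (h.step 0)
  obtain ⟨h1, rfl⟩ := step_omega.1 h
  exact ⟨by cases h1; rfl, .inl rfl⟩

theorem not_ellTrans_zero {E : Setoid (Proc 𝒜)} {l : Act 𝒜} {C : Quotient E} :
    ¬ EllTrans E zero l C := by
  rintro ⟨t, ht, hleaf⟩
  obtain ⟨u, hu⟩ := ht.exists_leaf
  obtain ⟨D, h, -⟩ := hleaf u hu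
  rw [(t.silentReachable hu.1).eq fun l D _ => not_step_zero] at h
  exact not_step_zero h

theorem IsBranchingBisim.not_rel_zero {E : Setoid (Proc 𝒜)} (hE : IsBranchingBisim E)
    {A A' : Proc 𝒜} {a : 𝒜} (h : A.Step (.act (.ext a)) A') : ¬ E.r A zero :=
  fun h' => not_ellTrans_zero ((hE A zero h' _).1 _ (.inl ⟨a, rfl⟩) (.of_step h rfl))

/-- The only extra transition of `looping` is its silent self-loop, which stays in the class. -/
theorem isBranchingBisim_looping (a : 𝒜) :
    IsBranchingBisim (pairSetoid (unrolled a) (looping a)) := by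
  refine isBranchingBisim_pair (fun l A' h => .inl ?_) (fun l A' h => ?_)
    (fun n w P h => h.not_act (step_unrolled.2 (.inl ⟨rfl, rfl⟩)))
    (fun n w P h => h.not_act (step_looping.2 (.inl ⟨rfl, rfl⟩)))
  · rw [step_unrolled] at h
    rw [step_looping]
    exact h.imp_right fun h => ⟨h.1, .inl h.2⟩
  · rw [step_looping] at h
    rw [step_unrolled]
    rcases h with h | ⟨h1, h | h⟩
    · exact .inl (.inl h)
    · exact .inl (.inr ⟨h1, h⟩)
    · exact .inr ⟨by cases h1; rfl, .inr h⟩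

/-- Every end component contains `unrolled a` or `looping a`, since 0 is deadlocked and `gamble a`
would bring 0 along. The self-loop of `looping a`, silently reachable from both sides, is therefore
related to all of them. -/
theorem tauECInvariant_looping (a : 𝒜) :
    TauECInvariant (pairSetoid (unrolled a) (looping a)).r := by
  have hec : ∀ A : Proc 𝒜, (A = unrolled a ∨ A = looping a) → ∀ g, ReachesEC A g →
      ∃ C ∈ g.V, C = unrolled a ∨ C = looping a := by
    intro A hA g hg
    obtain ⟨hg, C, -, hC⟩ := hg
    by_contra hn
    push Not at hn
    have hmem : ∀ C ∈ g.V, C ∈ ({unrolled a, looping a, gamble a, zero} : Set (Proc 𝒜)) := by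
      intro C hC
      refine (hg.vert C hC).mem ?_ ?_
      · rcases hA with rfl | rfl <;> simp
      · rintro C (rfl | rfl | rfl | rfl) l D h
        · rcases step_unrolled.1 h with ⟨-, rfl⟩ | ⟨-, rfl⟩ <;> simp
        · rcases step_looping.1 h with ⟨-, rfl⟩ | ⟨-, rfl | rfl⟩ <;> simp
        · rcases step_gamble h with rfl | rfl <;> simp
        · exact (not_step_zero h).elim
    have h0 : zero ∉ g.V := by
      intro h
      obtain ⟨l, D, _, h, _⟩ := hg.exists_step h
      exact not_step_zero h
    rcases hmem C hC with rfl | rfl | rfl | rfl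
    · exact (hn _ hC).1 rfl
    · exact (hn _ hC).2 rfl
    · obtain ⟨l, D, hD⟩ := hg.exists_edge hC
      exact h0 (zero_mem_of_silentInto_gamble (hg.silentInto hD))
    · exact h0 hC
  have hloop : ∀ A B : Proc 𝒜, (A = unrolled a ∨ A = looping a) → SilentReachable B (looping a) →
      ∀ g, ReachesEC A g →
      ∃ g', ReachesEC B g' ∧ RelatedEC (pairSetoid (unrolled a) (looping a)).r g g' := by
    intro A B hA hB g hg
    obtain ⟨g', h1, h2⟩ := exists_reachesEC_of_loop (step_looping.2 (.inr ⟨rfl, .inr rfl⟩)) hB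
    obtain ⟨C, hC, hC'⟩ := hec A hA g hg
    exact ⟨g', h1, fun D hD => ⟨C, hC, .inr ⟨hC', .inr (h2 hD)⟩⟩⟩
  refine tauECInvariant_pair (hloop _ _ (.inl rfl) .refl) (hloop _ _ (.inr rfl) ?_)
  have h1 : SilentReachable (unrolled a) (gamble a) :=
    .single ⟨_, Label.silent_tau, step_unrolled.2 (.inr ⟨rfl, rfl⟩)⟩
  exact h1.tail Label.silent_ptau (collStep_gamble.step 0)

/-- A divergent tree of `unrolled a` would have to pass through `gamble a` and then contain 0, which
cannot be equivalent to a process with an external action. -/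
theorem IsBranchingBisim.not_rel_looping {E : Setoid (Proc 𝒜)} (hE : IsBranchingBisim E)
    (hd : DivPreserving E) (a : 𝒜) : ¬ E.r (unrolled a) (looping a) := by
  intro h
  have h1 : Diverges E (looping a) := diverges_of_silentInto (S := {looping a}) rfl (by
    rintro C rfl
    exact ⟨E.refl' _, .inl ⟨_, rfl, step_looping.2 (.inr ⟨rfl, .inr rfl⟩)⟩⟩)
  obtain ⟨S, hS, hS'⟩ := ((hd _ _ h).2 h1).exists_set
  have h2 : gamble a ∈ S := by
    rcases (hS' _ hS).2.2 with ⟨D, hD, h⟩ | ⟨n, w, P, h, -⟩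
    · rcases step_unrolled.1 h with ⟨h, -⟩ | ⟨-, rfl⟩
      · cases h
      · exact hD
    · exact (h.not_act (step_unrolled.2 (.inl ⟨rfl, rfl⟩))).elim
  have h3 : zero ∈ S := zero_mem_of_silentInto_gamble (hS' _ h2).2.2
  exact hE.not_rel_zero (step_unrolled.2 (.inl ⟨rfl, rfl⟩)) (E.symm' (hS' _ h3).2.1)

theorem not_reachesEC_choice {a : 𝒜} {A : Proc 𝒜} (hA : A = choice' a ∨ A = choice a)
    (g : Graph 𝒜) : ¬ ReachesEC A g := by
  rintro ⟨hg, C, -, hC⟩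
  have h0 : zero ∉ g.V := by
    intro h
    obtain ⟨l, D, _, h, _⟩ := hg.exists_step h
    exact not_step_zero h
  have h1 : single a ∉ g.V := by
    intro h
    obtain ⟨l, D, hl, h, _⟩ := hg.exists_step h
    rw [(step_single.1 h).1] at hl
    exact hl
  have hmem : C ∈ ({choice' a, choice a, single a, zero} : Set (Proc 𝒜)) := by
    refine (hg.vert C hC).mem ?_ ?_
    · rcases hA with rfl | rfl <;> simp
    · rintro C (rfl | rfl | rfl | rfl) l D h
      · rcases step_choice'.1 h with ⟨-, rfl | rfl⟩ | ⟨-, rfl⟩ <;> simp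
      · rcases step_choice.1 h with ⟨-, rfl | rfl⟩ <;> simp
      · obtain ⟨-, rfl⟩ := step_single.1 h; simp
      · exact (not_step_zero h).elim
  obtain ⟨l, D, hl, h, hD⟩ := hg.exists_step hC
  rcases hmem with rfl | rfl | rfl | rfl
  · rcases step_choice'.1 h with ⟨-, rfl | rfl⟩ | ⟨-, rfl⟩
    exacts [h1 hD, h0 hD, h0 hD]
  · rcases step_choice.1 h with ⟨-, rfl | rfl⟩
    exacts [h1 hD, h0 hD]
  · exact h1 hC
  · exact h0 hC

theorem tauECInvariant_choice (a : 𝒜) : TauECInvariant (pairSetoid (choice' a) (choice a)).r :=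
  tauECInvariant_pair (fun g h => (not_reachesEC_choice (.inl rfl) g h).elim)
    (fun g h => (not_reachesEC_choice (.inr rfl) g h).elim)

theorem isWeakBisim_choice (a : 𝒜) : IsWeakBisim (pairSetoid (choice' a) (choice a)) := by
  refine isWeakBisim_pair (fun α ρ h => ?_) (fun α ρ h => ?_)
  · rcases h.cases' with ⟨A', hs, rfl⟩ | ⟨rfl, n, w, P, hs, -⟩
    · rcases step_choice'.1 hs with h' | ⟨h1, rfl⟩
      · exact .inl (Step.pStep (step_choice.2 h'))
      · obtain rfl : α = .ext a := by cases h1; rfl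
        right
        -- The extra `a` of `choice'` is matched by τ to `single a` followed by `a`.
        obtain ⟨ρ, h2, h3⟩ := exists_weakCombined_of_near (R := {choice a, single a})
          (B := choice a) (l := .ext a) (T := fun D => D = zero) (by simp) (by simp)
          (fun h => by cases h) (by
            have hs : Near {choice a, single a}
                (fun D => ∃ D', D.Step (.act (.ext a)) D' ∧ D' = zero) 0 (single a) :=
              ⟨zero, step_single.2 ⟨rfl, rfl⟩, rfl⟩
            rintro D (rfl | rfl)
            · refine ⟨1, _, Step.pStep (step_choice.2 ⟨rfl, .inl rfl⟩), fun D hD => ?_,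
                single a, by simp, hs⟩
              refine .inr (by_contra fun hn => hD ?_)
              exact PMF.pure_apply_of_ne _ _ hn
            · exact ⟨0, hs⟩)
        refine ⟨ρ, h2, lift_of_support (C := Quotient.mk _ zero) (fun D hD => ?_)
          fun D hD => by rw [h3 D hD]⟩
        by_contra hn
        exact hD (PMF.pure_apply_of_ne _ _ fun e => hn (by rw [e]))
    · exact (hs.not_act (step_choice'.2 (.inr ⟨rfl, rfl⟩))).elim
  · rcases h.cases' with ⟨A', hs, rfl⟩ | ⟨rfl, n, w, P, hs, -⟩
    · exact Step.pStep (step_choice'.2 (.inl (step_choice.1 hs)))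
    · exact (hs.not_act (step_choice.2 ⟨rfl, .inl rfl⟩)).elim

/-- To match `a`, `choice a` must first move silently inside its class, to `single a` or 0. Neither
is equivalent to it: `single a` cannot match the silent step to 0, and 0 cannot perform `a`. -/
theorem IsBranchingBisim.not_rel_choice {E : Setoid (Proc 𝒜)} (hE : IsBranchingBisim E) (a : 𝒜) :
    ¬ E.r (choice' a) (choice a) := by
  intro h
  have hs : (single a).Step (.act (.ext a)) zero := step_single.2 ⟨rfl, rfl⟩
  have hc : (choice' a).Step (.act (.ext a)) zero := step_choice'.2 (.inr ⟨rfl, rfl⟩)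
  have key : ∀ D : Proc 𝒜, D = single a ∨ D = zero → ¬ E.r D (choice a) := by
    rintro D (rfl | rfl) hD
    · have h0 : Quotient.mk E zero ≠ Quotient.mk E (choice a) := fun e =>
        hE.not_rel_zero hs (E.trans' hD (E.symm' (Quotient.exact e)))
      obtain ⟨t, ht, hleaf⟩ := (hE _ _ (E.symm' hD) (Quotient.mk E zero)).1 .tau (.inr ⟨rfl, h0⟩)
        (.of_step (step_choice.2 ⟨rfl, .inr rfl⟩) rfl)
      obtain ⟨u, hu⟩ := ht.exists_leaf
      obtain ⟨D, h1, -⟩ := hleaf u hu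
      rw [(t.silentReachable hu.1).eq fun l D hl h => by
        rw [(step_single.1 h).1] at hl; exact hl] at h1
      cases (step_single.1 h1).1
    · exact hE.not_rel_zero hc (E.trans' h (E.symm' hD))
  obtain ⟨t, ht, hleaf⟩ := (hE _ _ h (Quotient.mk E zero)).1 (.ext a) (.inl ⟨a, rfl⟩)
    (.of_step hc rfl)
  by_cases h0 : t.arity [] = 0
  · obtain ⟨D, h1, -⟩ := hleaf [] ⟨t.isNode_nil, h0⟩
    rw [t.lab_root] at h1
    cases (step_choice.1 h1).1
  · rcases t.silentInto t.isNode_nil h0 with ⟨D, ⟨i, hi, rfl⟩, h1⟩ | ⟨n, w, P, h1, -⟩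
    · rw [t.lab_root] at h1
      exact key _ (step_choice.1 h1).2 (t.lab_mem _ hi)
    · rw [t.lab_root] at h1
      exact h1.not_act (step_choice.2 ⟨rfl, .inl rfl⟩)

/-! ### Inclusions and strictness -/

theorem branchingBisimDelta_subset : branchingBisimDelta 𝒜 ⊆ branchingBisimExh 𝒜 :=
  fun _ ⟨E, ⟨h1, h2⟩, h3⟩ => ⟨E, ⟨h1, h1.tauECInvariant h2⟩, h3⟩

theorem branchingBisimExh_subset : branchingBisimExh 𝒜 ⊆ branchingBisim 𝒜 :=
  fun _ ⟨E, h1, h2⟩ => ⟨E, h1.1, h2⟩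

theorem weakBisimExh_subset : weakBisimExh 𝒜 ⊆ weakBisim 𝒜 :=
  fun _ ⟨E, h1, h2⟩ => ⟨E, h1.1, h2⟩

theorem branchingBisim_subset_weakBisim : branchingBisim 𝒜 ⊆ weakBisim 𝒜 :=
  fun _ ⟨E, h1, h2⟩ => ⟨E, h1.isWeakBisim, h2⟩

theorem branchingBisimExh_subset_weakBisimExh : branchingBisimExh 𝒜 ⊆ weakBisimExh 𝒜 :=
  fun _ ⟨E, h1, h2⟩ => ⟨E, ⟨h1.1.isWeakBisim, h1.2⟩, h2⟩

theorem not_branchingBisimExh_subset_delta [Nonempty 𝒜] :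
    ¬ branchingBisimExh 𝒜 ⊆ branchingBisimDelta 𝒜 := by
  obtain ⟨a⟩ := ‹Nonempty 𝒜›
  intro h
  obtain ⟨E, ⟨h1, h2⟩, h3⟩ := h (a := (unrolled a, looping a))
    ⟨_, ⟨isBranchingBisim_looping a, tauECInvariant_looping a⟩, pairSetoid_rel _ _⟩
  exact h1.not_rel_looping h2 a h3

theorem omega_mem_branchingBisim : (omega, zero) ∈ branchingBisim 𝒜 :=
  ⟨_, isBranchingBisim_omega, pairSetoid_rel _ _⟩

theorem omega_notMem_weakBisimExh : (omega, zero) ∉ weakBisimExh 𝒜 :=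
  fun ⟨_, h1, h2⟩ => not_tauECInvariant_omega h1.2 h2

theorem not_weakBisimExh_subset_branchingBisim [Nonempty 𝒜] :
    ¬ weakBisimExh 𝒜 ⊆ branchingBisim 𝒜 := by
  obtain ⟨a⟩ := ‹Nonempty 𝒜›
  intro h
  obtain ⟨E, h1, h2⟩ := h (a := (choice' a, choice a))
    ⟨_, ⟨isWeakBisim_choice a, tauECInvariant_choice a⟩, pairSetoid_rel _ _⟩
  exact h1.not_rel_choice a h2

end RCCS

theorem theorem4p3 (𝒜 : Type*) [Nonempty 𝒜] :
    (RCCS.branchingBisimDelta 𝒜 ⊂ RCCS.branchingBisimExh 𝒜 ∧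
      RCCS.branchingBisimExh 𝒜 ⊂ RCCS.branchingBisim 𝒜 ∧
      RCCS.weakBisimExh 𝒜 ⊂ RCCS.weakBisim 𝒜) ∧
    (RCCS.branchingBisim 𝒜 ⊂ RCCS.weakBisim 𝒜 ∧
      RCCS.branchingBisimExh 𝒜 ⊂ RCCS.weakBisimExh 𝒜 ∧
      ¬ RCCS.weakBisimExh 𝒜 ⊆ RCCS.branchingBisim 𝒜 ∧
      ¬ RCCS.branchingBisim 𝒜 ⊆ RCCS.weakBisimExh 𝒜) := by
  have h : ¬ RCCS.branchingBisim 𝒜 ⊆ RCCS.weakBisimExh 𝒜 := fun h =>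
    RCCS.omega_notMem_weakBisimExh (h RCCS.omega_mem_branchingBisim)
  have h' := RCCS.not_weakBisimExh_subset_branchingBisim (𝒜 := 𝒜)
  -- Only the first strictness needs its own pair: equality in any of the other four inclusions
  -- would, chained with the inclusions, contradict `h` or `h'`.
  refine ⟨⟨⟨RCCS.branchingBisimDelta_subset, RCCS.not_branchingBisimExh_subset_delta⟩,
    ⟨RCCS.branchingBisimExh_subset, fun h1 =>
      h (h1.trans RCCS.branchingBisimExh_subset_weakBisimExh)⟩,
    ⟨RCCS.weakBisimExh_subset, fun h1 => h (RCCS.branchingBisim_subset_weakBisim.trans h1)⟩⟩,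
    ⟨RCCS.branchingBisim_subset_weakBisim, fun h1 => h' (RCCS.weakBisimExh_subset.trans h1)⟩,
    ⟨RCCS.branchingBisimExh_subset_weakBisimExh, fun h1 =>
      h' (h1.trans RCCS.branchingBisimExh_subset)⟩, h', h⟩
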